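/- **Setting.** A metric space $T$ is a *(real) tree* if (i) for all $u,v\in T$ there is a unique isometric embedding $\phi_{u,v}:[0,d(u,v)]\to T$ with $\phi_{u,v}(0)=u$, $\phi_{u,v}(d(u,v))=v$, and (ii) every injective continuous $\kappa:[0,1]\to T$ satisfies $\kappa([0,1])=\phi_{\kappa(0),\kappa(1)}([0,d(\kappa(0),\kappa(1))])$. Let $(X,d)$ be a locally compact, connected, separable metric space which is a *uniform local tree*: there is $0<\underline\iota\le\operatorname{diam}(X)$ such that every open ball $B(x,\underline\iota)$ is a tree. For $d(x,y)<\underline\iota$ put $]x,y[\,=\phi_{x,y}(]0,d(x,y)[)$. Let $\mathcal S=\bigcup_{d(x,y)<\underline\iota}\,]x,y[$ be the skeleton and let $\nu$ be the length measure on $\mathcal S$, i.e. the one-dimensional Hausdorff measure restricted to $\mathcal S$ (the unique Borel measure carried by $\mathcal S$ with $\nu(]x,y[)=d(x,y)$ whenever $d(x,y)<\underline\iota$). A continuous $f:X\to\mathbb R$ is *absolutely continuous* if for every $x\in X$ there is a $\nu$-measurable function $\partial_xf$ on $\mathcal S\cap B(x,\underline\iota)$ which, for every $u\in B(x,\underline\iota)$,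 is $\nu$-integrable on $]x,u[$ and satisfies $f(u)-f(x)=\int_{]x,u[}\partial_xf\,d\nu$. Then $|\partial f|$ denotes the ($\nu$-a.e. unique) function on $\mathcal S$ with $|\partial f|=|\partial_xf|$ $\nu$-a.e. on $\mathcal S\cap B(x,\underline\iota)$ for every $x$. For a Radon measure $m$ on $X$ with full support, $W^{1,p}(X,m)$ is the set of $f\in L^p(X,m)$ having an absolutely continuous $m$-representative $\tilde f$ with $|\partial\tilde f|\in L^p(\mathcal S,\nu)$; one writes $|\partial f|:=|\partial\tilde f|$. Let $r_0>0$ and let $\Phi:[0,r_0]\to[0,\infty)$ be nondecreasing, positive on $(0,r_0]$, such that for some $c_1,C_1>0$ and $\alpha\ge1$ $$c_1\frac Rr\le\frac{\Phi(R)}{\Phi(r)}\le C_1\Big(\frac Rr\Big)^{\alpha}\qquad(0<r\le R\le r_0),$$ and assume the uniform volume control: for some $c_2,C_2>0$, $c_2\Phi(r)\le m(B(x,r))\le C_2\Phi(r)$ for all $x\in X$, $0<r<r_0$. For $p>1$ put $\Psi_p(r)=r^{p-1}\Phi(r)$, $$E_{p,\Psi_p}(f,r)=\frac1{\Psi_p(r)}\int_X\frac1{m(B(x,r))}\int_{B(x,r)}|f(y)-f(x)|^p\,dm(y)\,dm(x)\in[0,\infty],$$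 $$KS^{\alpha_p,\Psi_p}(X,m)=\Big\{f\in L^p(X,m):\ \limsup_{r\to0^+}E_{p,\Psi_p}(f,r)<\infty\Big\}.$$ **Theorem.** Let $p>1$. Then $KS^{\alpha_p,\Psi_p}(X,m)=W^{1,p}(X,m)$, and there are constants $c,C>0$ and $r_1\in(0,r_0]$ such that for every $f\in KS^{\alpha_p,\Psi_p}(X,m)$ $$c\sup_{r\in(0,r_1]}E_{p,\Psi_p}(f,r)\ \le\ \int_{\mathcal S}|\partial f|^p\,d\nu\ \le\ C\liminf_{r\to0^+}E_{p,\Psi_p}(f,r).$$ In particular, for every such $f$, $\ \sup_{r\in(0,r_1]}E_{p,\Psi_p}(f,r)\le\frac Cc\,\liminf_{r\to0^+}E_{p,\Psi_p}(f,r)$. -/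

import Mathlib

open MeasureTheory Set Filter Topology
open scoped ENNReal

noncomputable section

namespace LocalTree

/-- `φ`, restricted to `[0, d(x, y)]`, is an isometric embedding of that interval which starts at
`x` and ends at `y`. Values of `φ` outside the interval are irrelevant. -/
def IsGeodesic {T : Type*} [MetricSpace T] (x y : T) (φ : ℝ → T) : Prop :=
  φ 0 = x ∧ φ (dist x y) = y ∧
    ∀ s ∈ Icc 0 (dist x y), ∀ t ∈ Icc 0 (dist x y), dist (φ s) (φ t) = |s - t|

/-- The closed segment `[x, y]`: the image `φ ([0, d(x, y)])` of the geodesic from `x` to `y`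
(the union of these images, should the geodesic not be unique). -/
def closedSeg {T : Type*} [MetricSpace T] (x y : T) : Set T :=
  {z | ∃ φ : ℝ → T, IsGeodesic x y φ ∧ z ∈ φ '' Icc 0 (dist x y)}

/-- The open segment `]x, y[`: the image `φ (]0, d(x, y)[)` of the geodesic from `x` to `y`
(the union of these images, should the geodesic not be unique). -/
def openSeg {T : Type*} [MetricSpace T] (x y : T) : Set T :=
  {z | ∃ φ : ℝ → T, IsGeodesic x y φ ∧ z ∈ φ '' Ioo 0 (dist x y)}

/-- A (real) tree: geodesics exist and are unique, and there are no loops. -/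
structure IsRealTree (T : Type*) [MetricSpace T] : Prop where
  exists_geodesic : ∀ u v : T, ∃ φ : ℝ → T, IsGeodesic u v φ
  unique_geodesic : ∀ (u v : T) (φ ψ : ℝ → T), IsGeodesic u v φ → IsGeodesic u v ψ →
    EqOn φ ψ (Icc 0 (dist u v))
  loop_free : ∀ κ : unitInterval → T, Continuous κ → Function.Injective κ →
    range κ = closedSeg (κ 0) (κ 1)

/-- `X` is a local tree, with radii `ι x`: every ball `B(x, ι x)`, with the induced metric, is a
real tree. -/
def IsLocalTree (X : Type*) [MetricSpace X] (ι : X → ℝ) : Prop :=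
  ∀ x : X, 0 < ι x ∧ IsRealTree (Metric.ball x (ι x))

/-- `X` is a uniform local tree, with uniform radius `ι₀` (the diameter may be infinite). -/
def IsUniformLocalTree (X : Type*) [MetricSpace X] (ι₀ : ℝ) : Prop :=
  IsLocalTree X (fun _ => ι₀) ∧ ENNReal.ofReal ι₀ ≤ Metric.ediam (univ : Set X)

section Gradient

variable {X : Type*} [MetricSpace X]

/-- The skeleton: the union of the open segments `]x, y[` with `d(x, y) < ι x`. -/
def skeleton (ι : X → ℝ) : Set X :=
  ⋃ x : X, ⋃ y ∈ Metric.ball x (ι x), openSeg x y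

variable [MeasurableSpace X] [BorelSpace X]

/-- The length measure `ν`, as a Borel measure on `X` carried by the skeleton: one-dimensional
Hausdorff measure on the skeleton. It gives every segment `]x, y[` with `d(x, y) < ι x` the mass
`d(x, y)`, see `lengthMeasure_openSeg`. -/
def lengthMeasure (ι : X → ℝ) : Measure X :=
  (Measure.hausdorffMeasure 1 : Measure X).restrict (skeleton ι)

theorem lengthMeasure_openSeg {ι : X → ℝ} (hX : IsLocalTree X ι) {x y : X}
    (hy : y ∈ Metric.ball x (ι x)) :
    lengthMeasure ι (openSeg x y) = ENNReal.ofReal (dist x y) := by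
  have hsub : openSeg x y ⊆ skeleton ι := fun z hz =>
    mem_iUnion.2 ⟨x, mem_iUnion₂.2 ⟨y, hy, hz⟩⟩
  have hlt : dist x y < ι x := by rwa [dist_comm]
  have hx : x ∈ Metric.ball x (ι x) := Metric.mem_ball_self (hX x).1
  obtain ⟨φ, h0, h1, hφ⟩ := (hX x).2.exists_geodesic ⟨x, hx⟩ ⟨y, hy⟩
  have hd : dist (⟨x, hx⟩ : Metric.ball x (ι x)) ⟨y, hy⟩ = dist x y := rfl
  rw [hd] at h1 hφ
  -- every geodesic of `X` from `x` to `y` stays in the ball, hence is the one of the tree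
  have key : ∀ ψ : ℝ → X, IsGeodesic x y ψ →
      EqOn ψ (fun t => (φ t : X)) (Icc 0 (dist x y)) := by
    rintro ψ ⟨p0, p1, pd⟩
    have hmem : ∀ t ∈ Icc 0 (dist x y), ψ t ∈ Metric.ball x (ι x) := by
      intro t ht
      have h := pd t ht 0 ⟨le_rfl, dist_nonneg⟩
      rw [p0, sub_zero, abs_of_nonneg ht.1] at h
      rw [Metric.mem_ball, h]
      exact ht.2.trans_lt hlt
    classical
    let ψ' : ℝ → Metric.ball x (ι x) := fun t =>
      if ht : t ∈ Icc 0 (dist x y) then ⟨ψ t, hmem t ht⟩ else ⟨x, hx⟩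
    have hv : ∀ t ∈ Icc 0 (dist x y), (ψ' t : X) = ψ t := by
      intro t ht
      simp only [ψ', dif_pos ht]
    have hgeo : IsGeodesic (⟨x, hx⟩ : Metric.ball x (ι x)) ⟨y, hy⟩ ψ' := by
      refine ⟨Subtype.ext ?_, Subtype.ext ?_, ?_⟩
      · rw [hv 0 ⟨le_rfl, dist_nonneg⟩, p0]
      · rw [hd, hv _ ⟨dist_nonneg, le_rfl⟩, p1]
      · intro s hs t ht
        rw [Subtype.dist_eq, hv s hs, hv t ht]
        exact pd s hs t ht
    intro t ht
    have := (hX x).2.unique_geodesic _ _ ψ' φ hgeo ⟨h0, h1, hφ⟩ ht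
    change ψ t = (φ t : X)
    rw [← hv t ht, this]
  have himg : openSeg x y = (fun t : Icc 0 (dist x y) => (φ t : X)) ''
      (Subtype.val ⁻¹' Ioo 0 (dist x y)) := by
    ext z
    constructor
    · rintro ⟨ψ, hψ, t, ht, rfl⟩
      exact ⟨⟨t, Ioo_subset_Icc_self ht⟩, ht, (key ψ hψ (Ioo_subset_Icc_self ht)).symm⟩
    · rintro ⟨t, ht, rfl⟩
      refine ⟨fun t => (φ t : X), ⟨by simp [h0], by simp [h1], ?_⟩, t, ht, rfl⟩
      intro s hs t ht
      exact hφ s hs t ht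
  have hiso : Isometry (fun t : Icc 0 (dist x y) => (φ t : X)) :=
    Isometry.of_dist_eq fun s t => hφ s s.2 t t.2
  rw [lengthMeasure, Measure.restrict_eq_self _ hsub, himg,
    hiso.hausdorffMeasure_image (Or.inl zero_le_one),
    ← isometry_subtype_coe.hausdorffMeasure_image (Or.inl zero_le_one),
    Subtype.image_preimage_coe, inter_eq_self_of_subset_right Ioo_subset_Icc_self,
    hausdorffMeasure_real, Real.volume_Ioo, sub_zero]

/-- `g` is a weak gradient `∂ₓ f` of `f` in `B(x, ι x)`. Local integrability is integrability on
every segment `]x, u[` in the ball (balls may have infinite `ν`-measure). -/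
def IsWeakGradientAt (ι : X → ℝ) (f : X → ℝ) (x : X) (g : X → ℝ) : Prop :=
  AEStronglyMeasurable g ((lengthMeasure ι).restrict (Metric.ball x (ι x))) ∧
    ∀ u ∈ Metric.ball x (ι x), IntegrableOn g (openSeg x u) (lengthMeasure ι) ∧
      f u - f x = ∫ z in openSeg x u, g z ∂(lengthMeasure ι)

/-- `f ∈ AC(X)`: `f` is continuous, and absolutely continuous in every ball `B(x, ι x)`. -/
def IsAC (ι : X → ℝ) (f : X → ℝ) : Prop :=
  Continuous f ∧ ∀ x : X, ∃ g : X → ℝ, IsWeakGradientAt ι f x g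

/-- `G = |∂ f|` for the absolutely continuous function `f`: on every ball `B(x, ι x)`, `G` is
`ν`-a.e. the absolute value of the weak gradient `∂ₓ f` in that ball. -/
def IsGradientModulus (ι : X → ℝ) (f G : X → ℝ) : Prop :=
  IsAC ι f ∧ AEStronglyMeasurable G (lengthMeasure ι) ∧
    ∀ x : X, ∃ g : X → ℝ, IsWeakGradientAt ι f x g ∧
      ∀ᵐ z ∂((lengthMeasure ι).restrict (Metric.ball x (ι x))), G z = |g z|

/-- `f ∈ AC^p(X)`: `f` is absolutely continuous and `|∂ f| ∈ L^p(S, ν)`. -/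
def IsACp (ι : X → ℝ) (p : ℝ≥0∞) (f : X → ℝ) : Prop :=
  ∃ G : X → ℝ, IsGradientModulus ι f G ∧ MemLp G p (lengthMeasure ι)

/-- The Sobolev space `W^{1,p}(X, m)`: those `f ∈ L^p(X, m)` with an `m`-representative in
`AC^p(X)`. -/
def sobolevSpace (ι : X → ℝ) (m : Measure X) (p : ℝ≥0∞) : Set (Lp ℝ p m) :=
  {f | ∃ f' : X → ℝ, f =ᵐ[m] f' ∧ IsACp ι p f'}

end Gradient

section KorevaarSchoen

variable {X : Type*} [MetricSpace X] [MeasurableSpace X]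

/-- The Korevaar–Schoen functional
`E_{p,Ψ}(f, r) = Ψ(r)⁻¹ ∫_X m(B(x,r))⁻¹ ∫_{B(x,r)} |f(y) - f(x)|^p dm(y) dm(x)`,
with values in `[0, ∞]`. -/
def ksEnergy (m : Measure X) (p : ℝ) (Ψ : ℝ → ℝ) (f : X → ℝ) (r : ℝ) : ℝ≥0∞ :=
  (ENNReal.ofReal (Ψ r))⁻¹ *
    ∫⁻ x, (m (Metric.ball x r))⁻¹ * ∫⁻ y in Metric.ball x r, ‖f y - f x‖ₑ ^ p ∂m ∂m

/-- The Korevaar–Schoen space: those `f ∈ L^p(X, m)` with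
`limsup_{r → 0} E_{p,Ψ}(f, r) < ∞`. -/
def ksSpace (m : Measure X) (p : ℝ) (Ψ : ℝ → ℝ) : Set (Lp ℝ (ENNReal.ofReal p) m) :=
  {f | limsup (fun r : ℝ => ksEnergy m p Ψ f r) (𝓝[>] 0) < ⊤}

/-- The scaling function `Ψ_p(r) = r^{p-1} Φ(r)`. -/
def scaling (p : ℝ) (Φ : ℝ → ℝ) (r : ℝ) : ℝ := r ^ (p - 1) * Φ r

/-- The standing assumption on the volume profile `Φ : [0, r₀] → [0, ∞)`. Positivity on `]0, r₀]`
is what makes the quotients `Φ(R) / Φ(r)` meaningful. -/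
structure IsVolumeProfile (Φ : ℝ → ℝ) (r₀ : ℝ) : Prop where
  radius_pos : 0 < r₀
  nonneg : ∀ r ∈ Icc 0 r₀, 0 ≤ Φ r
  pos : ∀ r ∈ Ioc 0 r₀, 0 < Φ r
  monotone : MonotoneOn Φ (Icc 0 r₀)
  ratio : ∃ c C α : ℝ, 0 < c ∧ 0 < C ∧ 1 ≤ α ∧ ∀ r R : ℝ, 0 < r → r ≤ R → R ≤ r₀ →
    c * (R / r) ≤ Φ R / Φ r ∧ Φ R / Φ r ≤ C * (R / r) ^ α

/-- Uniform volume control: `c Φ(r) ≤ m(B(x, r)) ≤ C Φ(r)` for all `x` and `0 < r < r₀`. -/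
def UniformVolumeControl (m : Measure X) (Φ : ℝ → ℝ) (r₀ : ℝ) : Prop :=
  ∃ c C : ℝ, 0 < c ∧ 0 < C ∧ ∀ (x : X) (r : ℝ), 0 < r → r < r₀ →
    ENNReal.ofReal (c * Φ r) ≤ m (Metric.ball x r) ∧
      m (Metric.ball x r) ≤ ENNReal.ofReal (C * Φ r)

end KorevaarSchoen

end LocalTree

end

noncomputable section

namespace LocalTree

/-! ### Geodesics and the geometry of real trees. -/

section Geodesics

variable {T : Type*} [MetricSpace T]

/-! Both inequalities come from integrating along geodesics, where `f` is a function of one real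
variable.

Energy by gradient (`IsGradientModulus.ksEnergy_le`): for `d(x,y) < r`, Hölder on the segment gives
`|f y - f x|^p ≤ r^(p-1) ∫_{B(x,r)} |∂f|^p dν`. Integrating in `x`, Tonelli produces the factor
`m(B(z,r)) ≤ C Φ(r)`, and `Ψ_p(r) = r^(p-1) Φ(r)` cancels both factors at every small scale.

Gradient by energy (`IsGradientModulus.lintegral_le`): let `f_ε` be the mean of `f` over `ε`-balls.
By Jensen and doubling (`exists_averageBound`), `|f_ε(x) - f_ε(z)|^p` with `d(x,z) ≤ ε` is at most
`K/Φ(4ε)` times the integral over `B(x,ε)` of the local energy at scale `4ε`. Integrate this along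
geodesic pieces that are `2ε`-separated: an `ε`-ball meets only one of them, in length at most `2ε`,
so a step of length at most `ε` costs order `ε^p E(4ε)`. A chain of about `h/ε` steps costs order
`h^p E(4ε)`, whatever the number of pieces. Fatou as `ε → 0` with `h` fixed, and again as `h → 0`,
bounds the gradient by the lower limit of the energies. The skeleton is a countable union of
segments; it is cut into disjoint parts and exhausted by compact sets, finitely many of which are
always separated.

Equality of the spaces: under bounded energies the means over balls of dyadic radii converge
geometrically, because `p > 1`, to a continuous representative (`exists_continuous_ae_eq`). The
chain estimate on a single geodesic bounds its difference quotients in `L^p`, so it is absolutely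
continuous along geodesics. Radial derivatives are then weak gradients, and their moduli for
different centres agree a.e. because both are limits of `|f w - f z| / d(w,z)`
(`ae_abs_radialDeriv_eq`). -/

theorem IsGeodesic.dist_left {x y : T} {φ : ℝ → T} (h : IsGeodesic x y φ) {t : ℝ}
    (ht : t ∈ Icc 0 (dist x y)) : dist x (φ t) = t := by
  have := h.2.2 0 ⟨le_rfl, dist_nonneg⟩ t ht
  rw [h.1, zero_sub, abs_neg, abs_of_nonneg ht.1] at this
  exact this

theorem IsGeodesic.dist_right {x y : T} {φ : ℝ → T} (h : IsGeodesic x y φ) {t : ℝ}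
    (ht : t ∈ Icc 0 (dist x y)) : dist (φ t) y = dist x y - t := by
  have := h.2.2 t ht (dist x y) ⟨dist_nonneg, le_rfl⟩
  rw [h.2.1, abs_sub_comm, abs_of_nonneg (by linarith [ht.2])] at this
  exact this

theorem IsGeodesic.subpath {x y : T} {φ : ℝ → T} (h : IsGeodesic x y φ) {a b : ℝ}
    (ha : 0 ≤ a) (hab : a ≤ b) (hb : b ≤ dist x y) :
    IsGeodesic (φ a) (φ b) (fun t => φ (a + t)) := by
  have hd : dist (φ a) (φ b) = b - a := by
    rw [h.2.2 a ⟨ha, hab.trans hb⟩ b ⟨ha.trans hab, hb⟩, abs_sub_comm,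
      abs_of_nonneg (by linarith)]
  refine ⟨by simp, by simp [hd], ?_⟩
  rw [hd]
  intro s hs t ht
  rw [h.2.2 _ ⟨by linarith [hs.1], by linarith [hs.2]⟩ _ ⟨by linarith [ht.1], by linarith [ht.2]⟩]
  congr 1
  ring

theorem IsGeodesic.initial {x y : T} {φ : ℝ → T} (h : IsGeodesic x y φ) {t : ℝ}
    (ht : t ∈ Icc 0 (dist x y)) : IsGeodesic x (φ t) φ := by
  simpa [h.1] using h.subpath le_rfl ht.1 ht.2

/-- A shortcut between points of the two pieces would shorten the way from `x` to `y`; additivity of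
the distances excludes this, without any tree property. -/
theorem IsGeodesic.concat {x z y : T} {α β : ℝ → T} (hα : IsGeodesic x z α)
    (hβ : IsGeodesic z y β) (h : dist x z + dist z y = dist x y) :
    IsGeodesic x y (fun t => if t ≤ dist x z then α t else β (t - dist x z)) := by
  have hzy : 0 ≤ dist z y := dist_nonneg
  have hxz : 0 ≤ dist x z := dist_nonneg
  have key : ∀ s ∈ Icc 0 (dist x z), ∀ t ∈ Icc 0 (dist z y),
      dist (α s) (β t) = t + dist x z - s := by
    intro s hs t ht
    apply le_antisymm
    · have := dist_triangle (α s) z (β t)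
      rw [hα.dist_right hs, hβ.dist_left ht] at this
      linarith
    · have h1 := dist_triangle4 x (α s) (β t) y
      rw [hα.dist_left hs, hβ.dist_right ht] at h1
      linarith
  refine ⟨by simp [hα.1], ?_, ?_⟩
  · simp only
    split_ifs with h'
    · have h0 : dist z y = 0 := by linarith
      have : dist x y = dist x z := by linarith
      rw [this, hα.2.1, dist_eq_zero.1 h0]
    · rw [← h, add_sub_cancel_left, hβ.2.1]
  · intro s hs t ht
    simp only
    split_ifs with h1 h2 h2
    · exact hα.2.2 s ⟨hs.1, h1⟩ t ⟨ht.1, h2⟩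
    · push Not at h2
      rw [key s ⟨hs.1, h1⟩ _ ⟨by linarith, by linarith [ht.2]⟩, abs_sub_comm,
        abs_of_nonneg (by linarith)]
      ring
    · push Not at h1
      rw [dist_comm, key t ⟨ht.1, h2⟩ _ ⟨by linarith, by linarith [hs.2]⟩,
        abs_of_nonneg (by linarith)]
      ring
    · push Not at h1 h2
      rw [hβ.2.2 _ ⟨by linarith, by linarith [hs.2]⟩ _ ⟨by linarith, by linarith [ht.2]⟩]
      congr 1
      ring

/-- Values outside the interval are arbitrary, so the parameter is projected to it. This makes `φ`
continuous on all of `ℝ`, as the measure-theoretic arguments require. -/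
theorem IsGeodesic.exists_lipschitz {x y : T} {φ : ℝ → T} (h : IsGeodesic x y φ) :
    ∃ ψ : ℝ → T, IsGeodesic x y ψ ∧ LipschitzWith 1 ψ := by
  have h0 : (0 : ℝ) ≤ dist x y := dist_nonneg
  refine ⟨fun t => φ (projIcc 0 (dist x y) h0 t), ⟨?_, ?_, ?_⟩, ?_⟩
  · simp [h.1]
  · simp [h.2.1]
  · intro s hs t ht
    simp only [projIcc_of_mem h0 hs, projIcc_of_mem h0 ht]
    exact h.2.2 s hs t ht
  · refine LipschitzWith.of_dist_le_mul fun s t => ?_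
    rw [h.2.2 _ (projIcc 0 (dist x y) h0 s).2 _ (projIcc 0 (dist x y) h0 t).2, ← Real.dist_eq]
    exact (LipschitzWith.projIcc h0).dist_le_mul s t

theorem IsGeodesic.mem_openSeg {x y : T} {φ : ℝ → T} (h : IsGeodesic x y φ) {t : ℝ}
    (ht : t ∈ Ioo 0 (dist x y)) : φ t ∈ openSeg x y :=
  ⟨φ, h, t, ht, rfl⟩

/-- A point `z ≠ x, y` between `x` and `y` lies on the open segment. -/
theorem mem_openSeg_of_between {x z y : T} {α β : ℝ → T} (hα : IsGeodesic x z α)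
    (hβ : IsGeodesic z y β) (h : dist x z + dist z y = dist x y) (hx : z ≠ x) (hy : z ≠ y) :
    z ∈ openSeg x y := by
  have h1 : 0 < dist x z := dist_pos.2 hx.symm
  have h2 : 0 < dist z y := dist_pos.2 hy
  have := (hα.concat hβ h).mem_openSeg (t := dist x z) ⟨h1, by linarith⟩
  simpa [hα.2.1] using this

namespace IsRealTree

theorem eq_geodesic_of_between (hT : IsRealTree T) {x z y : T} {φ : ℝ → T}
    (hφ : IsGeodesic x y φ) (h : dist x z + dist z y = dist x y) : φ (dist x z) = z := by
  obtain ⟨α, hα⟩ := hT.exists_geodesic x z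
  obtain ⟨β, hβ⟩ := hT.exists_geodesic z y
  have hzy : 0 ≤ dist z y := dist_nonneg
  have := hT.unique_geodesic x y _ _ hφ (hα.concat hβ h) (x := dist x z)
    ⟨dist_nonneg, by linarith⟩
  rw [this]
  simp [hα.2.1]

theorem dist_of_between (hT : IsRealTree T) {x w z y : T} (hw : dist x w + dist w y = dist x y)
    (hz : dist x z + dist z y = dist x y) : dist w z = |dist x w - dist x z| := by
  obtain ⟨φ, hφ⟩ := hT.exists_geodesic x y
  have h1 := hT.eq_geodesic_of_between hφ hw
  have h2 := hT.eq_geodesic_of_between hφ hz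
  have hwy : 0 ≤ dist w y := dist_nonneg
  have hzy : 0 ≤ dist z y := dist_nonneg
  have := hφ.2.2 _ (⟨dist_nonneg, by linarith⟩ : dist x w ∈ Icc 0 (dist x y)) _
    (⟨dist_nonneg, by linarith⟩ : dist x z ∈ Icc 0 (dist x y))
  rwa [h1, h2] at this

/-- Two geodesics issued from `w` which only meet at `w` form a geodesic. -/
theorem between_of_disjoint (hT : IsRealTree T) {w x a : T} {α β : ℝ → T}
    (hα : IsGeodesic w x α) (hβ : IsGeodesic w a β)
    (h : ∀ s ∈ Icc 0 (dist w x), ∀ t ∈ Icc 0 (dist w a), α s = β t → s = 0 ∧ t = 0) :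
    dist x w + dist w a = dist x a := by
  obtain ⟨α', hα', hαL⟩ := hα.exists_lipschitz
  obtain ⟨β', hβ', hβL⟩ := hβ.exists_lipschitz
  have hαe := hT.unique_geodesic _ _ _ _ hα' hα
  have hβe := hT.unique_geodesic _ _ _ _ hβ' hβ
  have h0 : 0 ≤ dist w x := dist_nonneg
  have h1 : 0 ≤ dist w a := dist_nonneg
  rcases eq_or_ne x w with rfl | hxw
  · simp
  have hpos : 0 < dist w x := dist_pos.2 hxw.symm
  set L := dist w x + dist w a with hL
  have hLpos : 0 < L := by linarith
  -- Run `α` backwards from `x` to `w`, then `β` from `w` to `a`. The path is injective by `h`, so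
  -- loop-freeness puts `w` on the geodesic from `x` to `a`.
  let κ : unitInterval → T := fun s =>
    if L * (s : ℝ) ≤ dist w x then α' (dist w x - L * s) else β' (L * s - dist w x)
  have hκc : Continuous κ := by
    apply Continuous.if_le
    · exact hαL.continuous.comp (by fun_prop)
    · exact hβL.continuous.comp (by fun_prop)
    · fun_prop
    · fun_prop
    · intro s hs
      rw [hs, sub_self, hα'.1, hβ'.1]
  have hmem : ∀ s : unitInterval, 0 ≤ L * (s : ℝ) ∧ L * (s : ℝ) ≤ L := fun s =>
    ⟨mul_nonneg hLpos.le s.2.1, mul_le_of_le_one_right hLpos.le s.2.2⟩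
  have hκi : Function.Injective κ := by
    intro s t hst
    have hs := hmem s
    have ht := hmem t
    have fin : L * (s : ℝ) = L * (t : ℝ) → s = t := fun e =>
      Subtype.ext (mul_left_cancel₀ hLpos.ne' e)
    apply fin
    simp only [κ] at hst
    split_ifs at hst with h2 h3 h3
    · have := hα'.2.2 (dist w x - L * s) ⟨by linarith, by linarith⟩ (dist w x - L * t)
        ⟨by linarith, by linarith⟩
      rw [hst, dist_self] at this
      have := abs_eq_zero.1 this.symm
      linarith
    · push Not at h3
      rw [hαe ⟨by linarith, by linarith⟩, hβe ⟨by linarith, by linarith⟩] at hst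
      have := (h _ ⟨by linarith, by linarith⟩ _ ⟨by linarith, by linarith⟩ hst).2
      linarith
    · push Not at h2
      rw [hαe ⟨by linarith, by linarith⟩, hβe ⟨by linarith, by linarith⟩] at hst
      have := (h _ ⟨by linarith, by linarith⟩ _ ⟨by linarith, by linarith⟩ hst.symm).2
      linarith
    · push Not at h2 h3
      have := hβ'.2.2 (L * s - dist w x) ⟨by linarith, by linarith⟩ (L * t - dist w x)
        ⟨by linarith, by linarith⟩
      rw [hst, dist_self] at this
      have := abs_eq_zero.1 this.symm
      linarith
  have hr := hT.loop_free κ hκc hκi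
  have hκ0 : κ 0 = x := by simp [κ, hα'.2.1, h0]
  have hκ1 : κ 1 = a := by
    simp only [κ, Icc.coe_one, mul_one]
    split_ifs with h2
    · have h3 : dist w a = 0 := by linarith
      rw [hL, h3, add_zero, sub_self, hα'.1, dist_eq_zero.1 h3]
    · rw [hL, add_sub_cancel_left, hβ'.2.1]
  have hκw : κ ⟨dist w x / L, by positivity, (div_le_one hLpos).2 (by linarith)⟩ = w := by
    have : L * (dist w x / L) = dist w x := by field_simp
    simp [κ, this, hα'.1]
  rw [hκ0, hκ1] at hr
  have hw : w ∈ closedSeg x a := hr ▸ ⟨_, hκw⟩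
  obtain ⟨φ, hφ, t, ht, rfl⟩ := hw
  rw [hφ.dist_left ht, hφ.dist_right ht]
  ring

/-- Every triangle of a tree is a tripod. -/
theorem exists_center (hT : IsRealTree T) (u x a : T) :
    ∃ w, dist u w + dist w x = dist u x ∧ dist u w + dist w a = dist u a ∧
      dist x w + dist w a = dist x a := by
  obtain ⟨γ₀, hγ₀⟩ := hT.exists_geodesic u x
  obtain ⟨δ₀, hδ₀⟩ := hT.exists_geodesic u a
  obtain ⟨γ, hγ, hγL⟩ := hγ₀.exists_lipschitz
  obtain ⟨δ, hδ, hδL⟩ := hδ₀.exists_lipschitz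
  -- The centre is the last common point of the geodesics from `u`. Common points have equal
  -- parameters, namely their distance to `u`, so none lies beyond `τ`.
  let A : Set ℝ := Icc 0 (min (dist u x) (dist u a)) ∩ {t | γ t = δ t}
  have hAc : IsCompact A :=
    isCompact_Icc.inter_right (isClosed_eq hγL.continuous hδL.continuous)
  have hA0 : (0 : ℝ) ∈ A :=
    ⟨⟨le_rfl, le_min dist_nonneg dist_nonneg⟩, by simp [hγ.1, hδ.1]⟩
  have hτ := hAc.sSup_mem ⟨0, hA0⟩
  set τ := sSup A
  obtain ⟨⟨hτ0, hτ1⟩, hτe⟩ := hτ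
  have hτx := hτ1.trans (min_le_left _ _)
  have hτa := hτ1.trans (min_le_right _ _)
  change γ τ = δ τ at hτe
  have e1 := hγ.dist_left ⟨hτ0, hτx⟩
  have e2 := hγ.dist_right ⟨hτ0, hτx⟩
  have e3 := hδ.dist_right ⟨hτ0, hτa⟩
  refine ⟨γ τ, by rw [e1, e2]; ring, by rw [e1, hτe, e3]; ring, ?_⟩
  have g1 := hγ.subpath hτ0 hτx le_rfl
  have g2 := hδ.subpath hτ0 hτa le_rfl
  rw [hγ.2.1] at g1
  rw [hδ.2.1, ← hτe] at g2
  refine hT.between_of_disjoint g1 g2 ?_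
  intro s hs t ht hst
  rw [e2] at hs
  rw [hτe, e3] at ht
  have hs' : τ + s ∈ Icc 0 (dist u x) := ⟨by linarith [hs.1], by linarith [hs.2]⟩
  have ht' : τ + t ∈ Icc 0 (dist u a) := ⟨by linarith [ht.1], by linarith [ht.2]⟩
  have d1 := hγ.dist_left hs'
  have d2 := hδ.dist_left ht'
  change γ (τ + s) = δ (τ + t) at hst
  rw [hst, d2] at d1
  have hts : t = s := by linarith
  subst hts
  have : τ + t ≤ τ := le_csSup hAc.bddAbove ⟨⟨hs'.1, le_min hs'.2 ht'.2⟩, hst⟩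
  have : t = 0 := le_antisymm (by linarith) hs.1
  exact ⟨this, this⟩

/-- An interior point `z` of the segment `[a, b]` is an interior point of `[x, a]` or `[x, b]`. -/
theorem between_or_between (hT : IsRealTree T) {a b z : T} (hz : dist a z + dist z b = dist a b)
    (x : T) : dist x z + dist z a = dist x a ∨ dist x z + dist z b = dist x b := by
  -- `w` is where the way from `x` joins `[a, b]`. If it joins before `z`, seen from `a`, then `z`
  -- lies on the way to `b`; otherwise on the way to `a`.
  obtain ⟨w, h1, h2, h3⟩ := hT.exists_center a b x
  have hd := hT.dist_of_between h1 hz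
  rcases le_total (dist a w) (dist a z) with h | h
  · right
    rw [abs_of_nonpos (by linarith)] at hd
    apply le_antisymm _ (dist_triangle _ _ _)
    have t1 := dist_triangle x w z
    have s1 := dist_comm x w
    have s2 := dist_comm b w
    have s3 := dist_comm x b
    linarith
  · left
    rw [abs_of_nonneg (by linarith)] at hd
    apply le_antisymm _ (dist_triangle _ _ _)
    have t1 := dist_triangle x w z
    have s1 := dist_comm x w
    have s2 := dist_comm a z
    have s3 := dist_comm x a
    linarith

/-- Betweenness is stable under small perturbations of the end point. -/
theorem between_perturb (hT : IsRealTree T) {x z c u : T} (hz : dist x z + dist z c = dist x c)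
    (hu : dist u c < dist z c) : dist x z + dist z u = dist x u := by
  -- The branch point `w` satisfies `d(w,c) ≤ d(u,c) < d(z,c)`, so it lies beyond `z` and the way to
  -- `u` still passes through `z`.
  obtain ⟨w, h1, h2, h3⟩ := hT.exists_center x c u
  have hd := hT.dist_of_between h1 hz
  have s1 := dist_comm c w
  have s2 := dist_comm c u
  have p1 : 0 ≤ dist w u := dist_nonneg
  rw [abs_of_nonneg (by linarith)] at hd
  apply le_antisymm _ (dist_triangle _ _ _)
  have t1 := dist_triangle z w u
  have s3 := dist_comm w z
  linarith

end IsRealTree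

end Geodesics

/-! ### Segments of a local tree. -/

section Segments

variable {X : Type*} [MetricSpace X] {r : ℝ}

theorem exists_isGeodesic_of_mem_ball {c x y : X} (hT : IsRealTree (Metric.ball c r))
    (hx : x ∈ Metric.ball c r) (hy : y ∈ Metric.ball c r) : ∃ φ : ℝ → X, IsGeodesic x y φ := by
  obtain ⟨φ, h0, h1, h2⟩ := hT.exists_geodesic ⟨x, hx⟩ ⟨y, hy⟩
  exact ⟨fun t => φ t, congrArg Subtype.val h0, congrArg Subtype.val h1, h2⟩

variable (hX : IsLocalTree X (fun _ => r))
include hX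

theorem IsLocalTree.exists_isGeodesic {x y : X} (hxy : dist x y < r) :
    ∃ φ : ℝ → X, IsGeodesic x y φ ∧ LipschitzWith 1 φ := by
  obtain ⟨φ, hφ⟩ := exists_isGeodesic_of_mem_ball (hX x).2 (Metric.mem_ball_self (hX x).1)
    (by rwa [Metric.mem_ball, dist_comm])
  exact hφ.exists_lipschitz

theorem IsLocalTree.unique_isGeodesic {x y : X} (hxy : dist x y < r) {φ ψ : ℝ → X}
    (hφ : IsGeodesic x y φ) (hψ : IsGeodesic x y ψ) : EqOn φ ψ (Icc 0 (dist x y)) := by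
  classical
  have hx : x ∈ Metric.ball x r := Metric.mem_ball_self (hX x).1
  have hy : y ∈ Metric.ball x r := by rwa [Metric.mem_ball, dist_comm]
  have lift : ∀ ψ : ℝ → X, IsGeodesic x y ψ → ∃ ψ' : ℝ → Metric.ball x r,
      (∀ t ∈ Icc 0 (dist x y), (ψ' t : X) = ψ t) ∧
        IsGeodesic (⟨x, hx⟩ : Metric.ball x r) ⟨y, hy⟩ ψ' := by
    intro ψ hψ
    have hmem : ∀ t ∈ Icc 0 (dist x y), ψ t ∈ Metric.ball x r := by
      intro t ht
      rw [Metric.mem_ball, dist_comm, hψ.dist_left ht]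
      exact ht.2.trans_lt hxy
    have hv : ∀ t ∈ Icc 0 (dist x y), ((if ht : t ∈ Icc 0 (dist x y) then ⟨ψ t, hmem t ht⟩
        else ⟨x, hx⟩ : Metric.ball x r) : X) = ψ t := by
      intro t ht
      rw [dif_pos ht]
    have hd : dist (⟨x, hx⟩ : Metric.ball x r) ⟨y, hy⟩ = dist x y := rfl
    refine ⟨fun t => if ht : t ∈ Icc 0 (dist x y) then ⟨ψ t, hmem t ht⟩ else ⟨x, hx⟩, hv,
      Subtype.ext ?_, Subtype.ext ?_, ?_⟩
    · exact (hv 0 ⟨le_rfl, dist_nonneg⟩).trans hψ.1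
    · exact (hv _ ⟨dist_nonneg, le_rfl⟩).trans hψ.2.1
    · intro s hs t ht
      rw [Subtype.dist_eq, hv s hs, hv t ht]
      exact hψ.2.2 s hs t ht
  obtain ⟨φ', e1, g1⟩ := lift φ hφ
  obtain ⟨ψ', e2, g2⟩ := lift ψ hψ
  intro t ht
  rw [← e1 t ht, ← e2 t ht, (hX x).2.unique_geodesic _ _ _ _ g1 g2 ht]

theorem IsLocalTree.openSeg_eq_image {x y : X} (hxy : dist x y < r) {φ : ℝ → X}
    (hφ : IsGeodesic x y φ) : openSeg x y = φ '' Ioo 0 (dist x y) := by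
  apply Subset.antisymm
  · rintro z ⟨ψ, hψ, t, ht, rfl⟩
    exact ⟨t, ht, (hX.unique_isGeodesic hxy hψ hφ (Ioo_subset_Icc_self ht)).symm⟩
  · rintro z ⟨t, ht, rfl⟩
    exact hφ.mem_openSeg ht

/-- Every point `z ≠ x` of the skeleton in `B(x, r)` lies on a segment from `x` to a point of a
given dense set. -/
theorem IsLocalTree.exists_mem_openSeg_of_dense {D : Set X} (hD : Dense D) {x z : X}
    (hz : z ∈ skeleton (fun _ : X => r)) (hzx : dist x z < r) (hne : z ≠ x) :
    ∃ u ∈ D, dist x u < r ∧ z ∈ openSeg x u := by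
  simp only [skeleton, mem_iUnion, Metric.mem_ball] at hz
  obtain ⟨a, b, hab, φ, hφ, t, ht, rfl⟩ := hz
  obtain ⟨δ, hδ0, hδ1, hδ2, hδ3⟩ : ∃ δ, 0 < δ ∧ δ ≤ t ∧ δ ≤ dist a b - t ∧
      δ < r - dist x (φ t) := by
    have h1 := ht.1
    have h2 : 0 < dist a b - t := by linarith [ht.2]
    have h3 : 0 < r - dist x (φ t) := by linarith
    refine ⟨min (min t (dist a b - t)) ((r - dist x (φ t)) / 2), by positivity, ?_, ?_, ?_⟩
    · exact (min_le_left _ _).trans (min_le_left _ _)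
    · exact (min_le_left _ _).trans (min_le_right _ _)
    · exact (min_le_right _ _).trans_lt (by linarith)
  have m1 : t - δ ∈ Icc 0 (dist a b) := ⟨by linarith, by linarith⟩
  have m2 : t + δ ∈ Icc 0 (dist a b) := ⟨by linarith, by linarith⟩
  have m3 : t ∈ Icc 0 (dist a b) := Ioo_subset_Icc_self ht
  have d1 : dist (φ (t - δ)) (φ t) = δ := by
    rw [hφ.2.2 _ m1 _ m3, show t - δ - t = -δ by ring, abs_neg, abs_of_pos hδ0]
  have d2 : dist (φ t) (φ (t + δ)) = δ := by
    rw [hφ.2.2 _ m3 _ m2, show t - (t + δ) = -δ by ring, abs_neg, abs_of_pos hδ0]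
  have d3 : dist (φ (t - δ)) (φ (t + δ)) = 2 * δ := by
    rw [hφ.2.2 _ m1 _ m2, show t - δ - (t + δ) = -(2 * δ) by ring, abs_neg,
      abs_of_pos (by linarith)]
  have hxb : x ∈ Metric.ball x r := Metric.mem_ball_self (hX x).1
  have hzb : φ t ∈ Metric.ball x r := by rwa [Metric.mem_ball, dist_comm]
  have hab1 : φ (t - δ) ∈ Metric.ball x r := by
    rw [Metric.mem_ball, dist_comm]
    have := dist_triangle x (φ t) (φ (t - δ))
    rw [dist_comm (φ t), d1] at this
    linarith
  have hab2 : φ (t + δ) ∈ Metric.ball x r := by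
    rw [Metric.mem_ball, dist_comm]
    have := dist_triangle x (φ t) (φ (t + δ))
    rw [d2] at this
    linarith
  -- One of the two neighbours `φ (t ± δ)` lies behind `φ t` as seen from `x`; it can then be moved
  -- to a nearby point of `D` by `between_perturb`.
  obtain ⟨c, hc, hcz, hcb⟩ : ∃ c, c ∈ Metric.ball x r ∧ dist (φ t) c = δ ∧
      dist x (φ t) + dist (φ t) c = dist x c := by
    have := (hX x).2.between_or_between (a := ⟨φ (t - δ), hab1⟩) (b := ⟨φ (t + δ), hab2⟩)
      (z := ⟨φ t, hzb⟩) (by simp only [Subtype.dist_eq]; rw [d1, d2, d3]; ring) ⟨x, hxb⟩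
    simp only [Subtype.dist_eq] at this
    rcases this with h | h
    · exact ⟨_, hab1, by rw [dist_comm, d1], h⟩
    · exact ⟨_, hab2, d2, h⟩
  obtain ⟨u, hu, huD⟩ := hD.inter_open_nonempty (Metric.ball c δ ∩ Metric.ball x r)
    (Metric.isOpen_ball.inter Metric.isOpen_ball) ⟨c, Metric.mem_ball_self hδ0, hc⟩
  have hux : dist x u < r := by simpa [dist_comm] using hu.2
  have huc : dist u c < dist (φ t) c := by rw [hcz]; exact hu.1
  have hb := (hX x).2.between_perturb (x := ⟨x, hxb⟩) (z := ⟨φ t, hzb⟩) (c := ⟨c, hc⟩)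
    (u := ⟨u, hu.2⟩) hcb huc
  obtain ⟨α, hα⟩ := exists_isGeodesic_of_mem_ball (hX x).2 hxb hzb
  obtain ⟨β, hβ⟩ := exists_isGeodesic_of_mem_ball (hX x).2 hzb hu.2
  exact ⟨u, huD, hux, mem_openSeg_of_between hα hβ hb hne (by rintro rfl; exact lt_irrefl _ huc)⟩

/-- The first end point may also be taken in `D`: within `min t (r - t)` of `a` it stays different
from `z` and at distance less than `r` from it. -/
theorem IsLocalTree.exists_mem_openSeg_of_dense' {D : Set X} (hD : Dense D) {z : X}
    (hz : z ∈ skeleton (fun _ : X => r)) :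
    ∃ x ∈ D, ∃ u ∈ D, dist x u < r ∧ z ∈ openSeg x u := by
  have hz' := hz
  simp only [skeleton, mem_iUnion, Metric.mem_ball] at hz'
  obtain ⟨a, b, hab, φ, hφ, t, ht, rfl⟩ := hz'
  rw [dist_comm] at hab
  have hd := hφ.dist_left (Ioo_subset_Icc_self ht)
  obtain ⟨x, hx, hxD⟩ := hD.inter_open_nonempty (Metric.ball a (min t (r - t))) Metric.isOpen_ball
    ⟨a, Metric.mem_ball_self (lt_min ht.1 (by linarith [ht.2]))⟩
  rw [Metric.mem_ball, lt_min_iff] at hx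
  refine ⟨x, hxD, hX.exists_mem_openSeg_of_dense hD hz ?_ ?_⟩
  · have := dist_triangle x a (φ t)
    linarith
  · rintro rfl
    rw [dist_comm, hd] at hx
    exact lt_irrefl _ hx.1

end Segments

/-! ### Countable covers of the skeleton by segments. -/

section Segments

variable {X : Type*} [MetricSpace X] {r : ℝ}

theorem openSeg_subset_skeleton {x y : X} (hxy : dist x y < r) :
    openSeg x y ⊆ skeleton (fun _ : X => r) := fun z hz =>
  mem_iUnion.2 ⟨x, mem_iUnion₂.2 ⟨y, by rwa [Metric.mem_ball, dist_comm], hz⟩⟩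

variable (hX : IsLocalTree X (fun _ => r))
include hX

theorem IsLocalTree.openSeg_subset_ball {x y : X} (hxy : dist x y < r) :
    openSeg x y ⊆ Metric.ball x (dist x y) := by
  obtain ⟨φ, hφ, -⟩ := hX.exists_isGeodesic hxy
  rw [hX.openSeg_eq_image hxy hφ]
  rintro z ⟨t, ht, rfl⟩
  rw [Metric.mem_ball, dist_comm, hφ.dist_left (Ioo_subset_Icc_self ht)]
  exact ht.2

theorem IsLocalTree.exists_skeleton_inter_ball_subset [TopologicalSpace.SeparableSpace X]
    (x : X) :
    ∃ u : ℕ → X, (∀ n, dist x (u n) < r) ∧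
      skeleton (fun _ : X => r) ∩ Metric.ball x r ⊆ {x} ∪ ⋃ n, openSeg x (u n) := by
  obtain ⟨D, hDc, hD⟩ := TopologicalSpace.exists_countable_dense X
  have hr := (hX x).1
  obtain ⟨u₀, hu₀, hu₀D⟩ := hD.inter_open_nonempty (Metric.ball x r) Metric.isOpen_ball
    ⟨x, Metric.mem_ball_self hr⟩
  have hc : {u : X | u ∈ D ∧ dist x u < r}.Countable := hDc.mono fun q hq => hq.1
  obtain ⟨q, hq⟩ := hc.exists_eq_range ⟨u₀, hu₀D, by simpa [dist_comm] using hu₀⟩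
  have hq' : ∀ n, q n ∈ {u : X | u ∈ D ∧ dist x u < r} := fun n => hq ▸ mem_range_self n
  refine ⟨q, fun n => (hq' n).2, ?_⟩
  rintro z ⟨hz, hzx⟩
  by_cases hne : z = x
  · exact Or.inl hne
  right
  obtain ⟨u, hu, hxu, hzu⟩ := hX.exists_mem_openSeg_of_dense hD hz
    (by simpa [dist_comm] using hzx) hne
  have : u ∈ range q := hq ▸ ⟨hu, hxu⟩
  obtain ⟨n, rfl⟩ := this
  exact mem_iUnion.2 ⟨n, hzu⟩

theorem IsLocalTree.exists_skeleton_eq [TopologicalSpace.SeparableSpace X] [Nonempty X] :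
    ∃ x y : ℕ → X, (∀ n, dist (x n) (y n) < r) ∧
      skeleton (fun _ : X => r) = ⋃ n, openSeg (x n) (y n) := by
  obtain ⟨D, hDc, hD⟩ := TopologicalSpace.exists_countable_dense X
  obtain ⟨x₀, hx₀⟩ := hD.nonempty
  have hc : {q : X × X | q ∈ D ×ˢ D ∧ dist q.1 q.2 < r}.Countable :=
    (hDc.prod hDc).mono fun q hq => hq.1
  obtain ⟨q, hq⟩ := hc.exists_eq_range ⟨(x₀, x₀), ⟨hx₀, hx₀⟩, by simpa using (hX x₀).1⟩
  have hq' : ∀ n, q n ∈ {q : X × X | q ∈ D ×ˢ D ∧ dist q.1 q.2 < r} := fun n =>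
    hq ▸ mem_range_self n
  refine ⟨fun n => (q n).1, fun n => (q n).2, fun n => (hq' n).2, ?_⟩
  apply Subset.antisymm
  · intro z hz
    obtain ⟨x, hx, u, hu, hxu, hzu⟩ := hX.exists_mem_openSeg_of_dense' hD hz
    have : (x, u) ∈ range q := hq ▸ ⟨⟨hx, hu⟩, hxu⟩
    obtain ⟨n, hn⟩ := this
    exact mem_iUnion.2 ⟨n, by simpa [hn] using hzu⟩
  · exact iUnion_subset fun n => openSeg_subset_skeleton (hq' n).2

end Segments

/-! ### The length measure along geodesics. -/

section LengthMeasure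

variable {X : Type*} [MetricSpace X] [MeasurableSpace X] [BorelSpace X] {r : ℝ}

theorem IsGeodesic.injOn {T : Type*} [MetricSpace T] {x y : T} {φ : ℝ → T}
    (h : IsGeodesic x y φ) : InjOn φ (Icc 0 (dist x y)) := by
  intro s hs t ht hst
  have := h.2.2 s hs t ht
  rw [hst, dist_self] at this
  linarith [abs_eq_zero.1 this.symm]

theorem IsGeodesic.hausdorffMeasure_image {x y : X} {φ : ℝ → X} (h : IsGeodesic x y φ)
    {A : Set ℝ} (hA : A ⊆ Icc 0 (dist x y)) :
    (Measure.hausdorffMeasure 1 : Measure X) (φ '' A) = volume A := by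
  have hiso : Isometry (fun t : Icc 0 (dist x y) => φ t) :=
    Isometry.of_dist_eq fun s t => h.2.2 s s.2 t t.2
  have himg : φ '' A = (fun t : Icc 0 (dist x y) => φ t) '' (Subtype.val ⁻¹' A) := by
    ext z
    constructor
    · rintro ⟨t, ht, rfl⟩
      exact ⟨⟨t, hA ht⟩, ht, rfl⟩
    · rintro ⟨t, ht, rfl⟩
      exact ⟨t, ht, rfl⟩
  rw [himg, hiso.hausdorffMeasure_image (Or.inl zero_le_one),
    ← isometry_subtype_coe.hausdorffMeasure_image (Or.inl zero_le_one),
    Subtype.image_preimage_coe, inter_eq_self_of_subset_right hA, hausdorffMeasure_real]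

variable (hX : IsLocalTree X (fun _ => r))

instance lengthMeasure_nullSingletonClass (ι : X → ℝ) :
    NullSingletonClass (lengthMeasure ι) := by
  have := Measure.nullSingletonClass_hausdorff X (d := 1) one_pos
  unfold lengthMeasure
  infer_instance

include hX

theorem IsLocalTree.measurableSet_openSeg {x y : X} (hxy : dist x y < r) :
    MeasurableSet (openSeg x y) := by
  obtain ⟨φ, hφ, hL⟩ := hX.exists_isGeodesic hxy
  have hd : (0 : ℝ) ≤ dist x y := dist_nonneg
  have : openSeg x y = φ '' Icc 0 (dist x y) \ {x, y} := by
    rw [hX.openSeg_eq_image hxy hφ]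
    ext z
    constructor
    · rintro ⟨t, ht, rfl⟩
      refine ⟨⟨t, Ioo_subset_Icc_self ht, rfl⟩, ?_⟩
      rintro (h | h)
      · exact ht.1.ne' (hφ.injOn (Ioo_subset_Icc_self ht) ⟨le_rfl, hd⟩ (h.trans hφ.1.symm))
      · rw [mem_singleton_iff] at h
        exact ht.2.ne (hφ.injOn (Ioo_subset_Icc_self ht) ⟨hd, le_rfl⟩ (h.trans hφ.2.1.symm))
    · rintro ⟨⟨t, ht, rfl⟩, h⟩
      simp only [mem_insert_iff, mem_singleton_iff, not_or] at h
      refine ⟨t, ⟨lt_of_le_of_ne ht.1 ?_, lt_of_le_of_ne ht.2 ?_⟩, rfl⟩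
      · rintro rfl
        exact h.1 hφ.1
      · rintro rfl
        exact h.2 hφ.2.1
  rw [this]
  exact (isCompact_Icc.image hL.continuous).isClosed.measurableSet.diff
    (Set.toFinite _).measurableSet

theorem IsLocalTree.lengthMeasure_inter_openSeg {x y : X} (hxy : dist x y < r) {φ : ℝ → X}
    (hφ : IsGeodesic x y φ) (B : Set X) :
    lengthMeasure (fun _ => r) (B ∩ openSeg x y) = volume (φ ⁻¹' B ∩ Ioo 0 (dist x y)) := by
  rw [lengthMeasure, Measure.restrict_eq_self _
    (inter_subset_right.trans (openSeg_subset_skeleton hxy)), hX.openSeg_eq_image hxy hφ,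
    ← image_preimage_inter, hφ.hausdorffMeasure_image (inter_subset_right.trans Ioo_subset_Icc_self)]

theorem IsLocalTree.map_restrict_eq {x y : X} (hxy : dist x y < r) {φ : ℝ → X}
    (hφ : IsGeodesic x y φ) (hL : LipschitzWith 1 φ) :
    Measure.map φ (volume.restrict (Ioo 0 (dist x y))) =
      (lengthMeasure (fun _ => r)).restrict (openSeg x y) := by
  ext B hB
  rw [Measure.map_apply hL.continuous.measurable hB, Measure.restrict_apply hB,
    Measure.restrict_apply (hL.continuous.measurable hB),
    hX.lengthMeasure_inter_openSeg hxy hφ]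

/-- `P` may be non-measurable, because isometric images preserve the Hausdorff measure of arbitrary
sets. -/
theorem IsLocalTree.ae_openSeg_iff {x y : X} (hxy : dist x y < r) {φ : ℝ → X}
    (hφ : IsGeodesic x y φ) (P : X → Prop) :
    (∀ᵐ z ∂(lengthMeasure (fun _ => r)).restrict (openSeg x y), P z) ↔
      ∀ᵐ t ∂volume.restrict (Ioo 0 (dist x y)), P (φ t) := by
  rw [ae_iff, ae_iff, Measure.restrict_apply' (hX.measurableSet_openSeg hxy),
    Measure.restrict_apply' measurableSet_Ioo, hX.lengthMeasure_inter_openSeg hxy hφ]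
  rfl

theorem IsLocalTree.lintegral_openSeg {x y : X} (hxy : dist x y < r) {φ : ℝ → X}
    (hφ : IsGeodesic x y φ) (hL : LipschitzWith 1 φ) {F : X → ℝ≥0∞}
    (hF : AEMeasurable F ((lengthMeasure (fun _ => r)).restrict (openSeg x y))) :
    ∫⁻ z in openSeg x y, F z ∂lengthMeasure (fun _ => r) =
      ∫⁻ t in Ioo 0 (dist x y), F (φ t) := by
  rw [← hX.map_restrict_eq hxy hφ hL] at hF ⊢
  exact lintegral_map' hF hL.continuous.measurable.aemeasurable

theorem IsLocalTree.integral_openSeg {x y : X} (hxy : dist x y < r) {φ : ℝ → X}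
    (hφ : IsGeodesic x y φ) (hL : LipschitzWith 1 φ) {F : X → ℝ}
    (hF : AEStronglyMeasurable F ((lengthMeasure (fun _ => r)).restrict (openSeg x y))) :
    ∫ z in openSeg x y, F z ∂lengthMeasure (fun _ => r) =
      ∫ t in Ioo 0 (dist x y), F (φ t) := by
  rw [← hX.map_restrict_eq hxy hφ hL] at hF ⊢
  exact integral_map hL.continuous.measurable.aemeasurable hF

theorem IsLocalTree.integrableOn_openSeg_iff {x y : X} (hxy : dist x y < r) {φ : ℝ → X}
    (hφ : IsGeodesic x y φ) (hL : LipschitzWith 1 φ) {F : X → ℝ}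
    (hF : AEStronglyMeasurable F ((lengthMeasure (fun _ => r)).restrict (openSeg x y))) :
    IntegrableOn F (openSeg x y) (lengthMeasure (fun _ => r)) ↔
      IntegrableOn (fun t => F (φ t)) (Ioo 0 (dist x y)) := by
  unfold IntegrableOn
  rw [← hX.map_restrict_eq hxy hφ hL] at hF ⊢
  exact integrable_map_measure hF hL.continuous.measurable.aemeasurable

variable [TopologicalSpace.SeparableSpace X]

/-- Reduces a.e. statements on a ball to countably many segments from its centre; the centre itself,
which these segments omit, is a null set. -/
theorem IsLocalTree.restrict_ball_le (x : X) :
    ∃ u : ℕ → X, (∀ n, dist x (u n) < r) ∧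
      (lengthMeasure (fun _ => r)).restrict (Metric.ball x r) ≤
        (lengthMeasure (fun _ => r)).restrict (⋃ n, openSeg x (u n)) := by
  obtain ⟨u, hu, hsub⟩ := hX.exists_skeleton_inter_ball_subset x
  have := (Measure.nullSingletonClass_hausdorff X (d := 1) one_pos)
  refine ⟨u, hu, ?_⟩
  have hm : MeasurableSet (⋃ n, openSeg x (u n)) :=
    MeasurableSet.iUnion fun n => hX.measurableSet_openSeg (hu n)
  have hs : (⋃ n, openSeg x (u n)) ⊆ skeleton (fun _ : X => r) :=
    iUnion_subset fun n => openSeg_subset_skeleton (hu n)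
  rw [lengthMeasure, Measure.restrict_restrict Metric.isOpen_ball.measurableSet,
    Measure.restrict_restrict hm, inter_eq_self_of_subset_left hs, inter_comm]
  refine (Measure.restrict_mono hsub le_rfl).trans (le_of_eq ?_)
  refine Measure.restrict_congr_set ?_
  rw [union_comm]
  exact union_ae_eq_left_of_ae_eq_empty (by simp)

/-- Needed for Tonelli, since balls may have infinite length. The disjointed segments of a countable
cover have finite length. -/
theorem IsLocalTree.sFinite_lengthMeasure : SFinite (lengthMeasure (fun _ : X => r)) := by
  rcases isEmpty_or_nonempty X with h | h
  · have : lengthMeasure (fun _ : X => r) = 0 := Measure.eq_zero_of_isEmpty _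
    rw [this]
    infer_instance
  obtain ⟨x, y, hxy, hS⟩ := hX.exists_skeleton_eq
  have e : lengthMeasure (fun _ : X => r) =
      (lengthMeasure (fun _ : X => r)).restrict (⋃ n, openSeg (x n) (y n)) := by
    rw [← hS, lengthMeasure, Measure.restrict_restrict_of_subset Subset.rfl]
  rw [e, ← iUnion_disjointed, Measure.restrict_iUnion (disjoint_disjointed _)
    (MeasurableSet.disjointed fun n => hX.measurableSet_openSeg (hxy n))]
  have : ∀ n, IsFiniteMeasure ((lengthMeasure (fun _ : X => r)).restrict
      (disjointed (fun n => openSeg (x n) (y n)) n)) := fun n => by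
    refine ⟨?_⟩
    rw [Measure.restrict_apply_univ]
    refine (measure_mono (disjointed_subset _ n)).trans_lt ?_
    rw [lengthMeasure_openSeg hX (by rw [Metric.mem_ball, dist_comm]; exact hxy n)]
    exact ENNReal.ofReal_lt_top
  infer_instance

end LengthMeasure

/-! ### Weak gradients as derivatives along geodesics. -/

section WeakGradient

variable {X : Type*} [MetricSpace X] [MeasurableSpace X] [BorelSpace X] {r : ℝ}

/-- Hölder against the constant `1`. -/
theorem rpow_lintegral_le {α : Type*} [MeasurableSpace α] (μ : Measure α) {p : ℝ} (hp : 1 < p)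
    {F : α → ℝ≥0∞} (hF : AEMeasurable F μ) :
    (∫⁻ a, F a ∂μ) ^ p ≤ μ univ ^ (p - 1) * ∫⁻ a, F a ^ p ∂μ := by
  have hp0 : 0 < p := by linarith
  have hpq := Real.HolderConjugate.conjExponent hp
  have h := ENNReal.lintegral_mul_le_Lp_mul_Lq μ hpq hF (aemeasurable_const (b := (1 : ℝ≥0∞)))
  simp only [Pi.mul_apply, mul_one, ENNReal.one_rpow, lintegral_const, one_mul] at h
  calc (∫⁻ a, F a ∂μ) ^ p
      ≤ ((∫⁻ a, F a ^ p ∂μ) ^ (1 / p) * μ univ ^ (1 / p.conjExponent)) ^ p := by gcongr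
    _ = μ univ ^ (p - 1) * ∫⁻ a, F a ^ p ∂μ := by
      rw [ENNReal.mul_rpow_of_nonneg _ _ hp0.le, ← ENNReal.rpow_mul, ← ENNReal.rpow_mul,
        one_div_mul_cancel hp0.ne', ENNReal.rpow_one, mul_comm]
      congr 2
      rw [Real.conjExponent]
      field_simp

theorem IsWeakGradientAt.aestronglyMeasurable_openSeg (hX : IsLocalTree X (fun _ => r))
    {f g : X → ℝ} {x y : X} (hg : IsWeakGradientAt (fun _ => r) f x g) (hxy : dist x y < r) :
    AEStronglyMeasurable g ((lengthMeasure (fun _ => r)).restrict (openSeg x y)) :=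
  hg.1.mono_measure (Measure.restrict_mono
    ((hX.openSeg_subset_ball hxy).trans (Metric.ball_subset_ball hxy.le)) le_rfl)

theorem IsWeakGradientAt.intervalIntegrable (hX : IsLocalTree X (fun _ => r)) {f g : X → ℝ}
    {x y : X} (hg : IsWeakGradientAt (fun _ => r) f x g) (hxy : dist x y < r) {φ : ℝ → X}
    (hφ : IsGeodesic x y φ) (hL : LipschitzWith 1 φ) :
    IntervalIntegrable (fun t => g (φ t)) volume 0 (dist x y) := by
  rw [intervalIntegrable_iff_integrableOn_Ioo_of_le dist_nonneg,
    ← hX.integrableOn_openSeg_iff hxy hφ hL (hg.aestronglyMeasurable_openSeg hX hxy)]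
  exact (hg.2 y (by rwa [Metric.mem_ball, dist_comm])).1

theorem IsWeakGradientAt.apply_eq_add_integral (hX : IsLocalTree X (fun _ => r)) {f g : X → ℝ}
    {x y : X} (hg : IsWeakGradientAt (fun _ => r) f x g) (hxy : dist x y < r) {φ : ℝ → X}
    (hφ : IsGeodesic x y φ) (hL : LipschitzWith 1 φ) {t : ℝ} (ht : t ∈ Icc 0 (dist x y)) :
    f (φ t) = f x + ∫ s in 0..t, g (φ s) := by
  have hd := hφ.dist_left ht
  have hlt : dist x (φ t) < r := by rw [hd]; exact ht.2.trans_lt hxy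
  have h := (hg.2 (φ t) (by rwa [Metric.mem_ball, dist_comm])).2
  rw [hX.integral_openSeg hlt (hφ.initial ht) hL (hg.aestronglyMeasurable_openSeg hX hlt), hd] at h
  rw [intervalIntegral.integral_of_le ht.1, integral_Ioc_eq_integral_Ioo, ← h]
  ring

/-- Initial pieces of a geodesic are geodesics from the same point, so `f ∘ φ` is an indefinite
integral of `g ∘ φ` and Lebesgue differentiation applies. -/
theorem IsWeakGradientAt.ae_hasDerivAt (hX : IsLocalTree X (fun _ => r)) {f g : X → ℝ}
    {x y : X} (hg : IsWeakGradientAt (fun _ => r) f x g) (hxy : dist x y < r) {φ : ℝ → X}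
    (hφ : IsGeodesic x y φ) (hL : LipschitzWith 1 φ) :
    ∀ᵐ t ∂volume.restrict (Ioo 0 (dist x y)), HasDerivAt (fun s => f (φ s)) (g (φ t)) t := by
  rw [ae_restrict_iff' measurableSet_Ioo]
  filter_upwards [(hg.intervalIntegrable hX hxy hφ hL).ae_hasDerivAt_integral] with t h ht
  rw [uIcc_of_le dist_nonneg] at h
  refine ((h (Ioo_subset_Icc_self ht) 0 ⟨le_rfl, dist_nonneg⟩).const_add (f x)).congr_of_eventuallyEq
    ?_
  filter_upwards [Ioo_mem_nhds ht.1 ht.2] with s hs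
  exact hg.apply_eq_add_integral hX hxy hφ hL (Ioo_subset_Icc_self hs)

theorem IsGradientModulus.ae_hasDerivAt (hX : IsLocalTree X (fun _ => r)) {f G : X → ℝ}
    (hG : IsGradientModulus (fun _ => r) f G) {x y : X} (hxy : dist x y < r) {φ : ℝ → X}
    (hφ : IsGeodesic x y φ) (hL : LipschitzWith 1 φ) :
    ∀ᵐ t ∂volume.restrict (Ioo 0 (dist x y)),
      HasDerivAt (fun s => f (φ s)) (deriv (fun s => f (φ s)) t) t ∧
        G (φ t) = |deriv (fun s => f (φ s)) t| := by
  obtain ⟨g, hg, hGg⟩ := hG.2.2 x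
  have h := ae_mono (Measure.restrict_mono
    ((hX.openSeg_subset_ball hxy).trans (Metric.ball_subset_ball hxy.le)) le_rfl) hGg
  have h := (hX.ae_openSeg_iff hxy hφ _).1 h
  filter_upwards [h, hg.ae_hasDerivAt hX hxy hφ hL] with t h1 h2
  rw [h2.deriv]
  exact ⟨h2, h1⟩

theorem IsGradientModulus.enorm_sub_rpow_le (hX : IsLocalTree X (fun _ => r)) {f G : X → ℝ}
    (hG : IsGradientModulus (fun _ => r) f G) {p : ℝ} (hp : 1 < p) {x y : X} (hxy : dist x y < r) :
    ‖f y - f x‖ₑ ^ p ≤ ENNReal.ofReal (dist x y) ^ (p - 1) *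
      ∫⁻ z in openSeg x y, ‖G z‖ₑ ^ p ∂lengthMeasure (fun _ => r) := by
  obtain ⟨g, hg, hGg⟩ := hG.2.2 x
  have hy : y ∈ Metric.ball x r := by rwa [Metric.mem_ball, dist_comm]
  have h := ae_mono (Measure.restrict_mono
    ((hX.openSeg_subset_ball hxy).trans (Metric.ball_subset_ball hxy.le)) le_rfl) hGg
  have e : ∫⁻ z in openSeg x y, ‖g z‖ₑ ∂lengthMeasure (fun _ => r) =
      ∫⁻ z in openSeg x y, ‖G z‖ₑ ∂lengthMeasure (fun _ => r) := by
    refine lintegral_congr_ae ?_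
    filter_upwards [h] with z hz
    rw [hz, ← Real.norm_eq_abs, enorm_norm]
  calc ‖f y - f x‖ₑ ^ p ≤ (∫⁻ z in openSeg x y, ‖G z‖ₑ ∂lengthMeasure (fun _ => r)) ^ p := by
        rw [(hg.2 y hy).2, ← e]
        gcongr
        exact enorm_integral_le_lintegral_enorm _
    _ ≤ _ := by
        refine (rpow_lintegral_le _ hp hG.2.1.restrict.enorm).trans (le_of_eq ?_)
        rw [Measure.restrict_apply_univ, lengthMeasure_openSeg hX hy]

end WeakGradient

/-! ### Construction of the gradient from absolute continuity along geodesics. -/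

section Construction

/-- The isolated points of `A` form a discrete subspace, and discrete separable spaces are
countable. -/
theorem countable_setOf_isolated {α : Type*} [TopologicalSpace α] [SecondCountableTopology α]
    (A : Set α) : {z | z ∈ A ∧ 𝓝[A \ {z}] z = ⊥}.Countable := by
  set I := {z | z ∈ A ∧ 𝓝[A \ {z}] z = ⊥} with hI
  have hd : IsDiscrete I := by
    rw [isDiscrete_iff_nhdsNE]
    intro z hz
    rw [nhdsWithin, inf_assoc, inf_principal, eq_bot_iff, ← hz.2, nhdsWithin]
    refine inf_le_inf_left _ (principal_mono.2 ?_)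
    rintro w ⟨hw, hwI⟩
    exact ⟨hwI.1, hw⟩
  have := hd.to_subtype
  exact Set.countable_coe_iff.mp (TopologicalSpace.separableSpace_iff_countable.mp inferInstance)

variable {X : Type*} [MetricSpace X] {r : ℝ}

/-- A geodesic from `x` to `z`, if there is one. -/
def chosenGeodesic (x z : X) : ℝ → X :=
  open Classical in if h : ∃ φ : ℝ → X, IsGeodesic x z φ then h.choose else fun _ => x

/-- The derivative of `f` at `z` along the geodesic which comes from `x`. -/
def radialDeriv (f : X → ℝ) (x z : X) : ℝ :=
  derivWithin (fun t => f (chosenGeodesic x z t)) (Icc 0 (dist x z)) (dist x z)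

theorem radialDeriv_eq (hX : IsLocalTree X (fun _ => r)) {f : X → ℝ} {x y : X}
    (hxy : dist x y < r) {φ : ℝ → X} (hφ : IsGeodesic x y φ) {t D : ℝ} (ht : t ∈ Ioo 0 (dist x y))
    (hD : HasDerivAt (fun s => f (φ s)) D t) : radialDeriv f x (φ t) = D := by
  have ht' := Ioo_subset_Icc_self ht
  have hd := hφ.dist_left ht'
  have hex : ∃ ψ : ℝ → X, IsGeodesic x (φ t) ψ := ⟨φ, hφ.initial ht'⟩
  have hc : IsGeodesic x (φ t) (chosenGeodesic x (φ t)) := by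
    rw [chosenGeodesic, dif_pos hex]
    exact hex.choose_spec
  have he := hX.unique_isGeodesic (by rw [hd]; exact ht.2.trans hxy) hc (hφ.initial ht')
  rw [radialDeriv]
  rw [hd] at he ⊢
  have : HasDerivWithinAt (fun s => f (chosenGeodesic x (φ t) s)) D (Icc 0 t) t :=
    hD.hasDerivWithinAt.congr (fun s hs => by rw [he hs]) (by rw [he ⟨ht.1.le, le_rfl⟩])
  exact this.derivWithin (uniqueDiffOn_Icc ht.1 t ⟨ht.1.le, le_rfl⟩)

/-- The limit expresses `|D|` through distances and values of `f` alone, with no parametrisation;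
this is what allows different centres to be compared. -/
theorem tendsto_slope_openSeg (hX : IsLocalTree X (fun _ => r)) {f : X → ℝ} {x y : X}
    (hxy : dist x y < r) {φ : ℝ → X} (hφ : IsGeodesic x y φ) {t D : ℝ} (ht : t ∈ Ioo 0 (dist x y))
    (hD : HasDerivAt (fun s => f (φ s)) D t) :
    Tendsto (fun z => |f z - f (φ t)| / dist z (φ t)) (𝓝[openSeg x y \ {φ t}] (φ t)) (𝓝 |D|) := by
  have ht' := Ioo_subset_Icc_self ht
  have hd := hφ.dist_left ht'
  have hmem : ∀ z ∈ openSeg x y, dist x z ∈ Icc 0 (dist x y) ∧ φ (dist x z) = z := by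
    intro z hz
    rw [hX.openSeg_eq_image hxy hφ] at hz
    obtain ⟨s, hs, rfl⟩ := hz
    rw [hφ.dist_left (Ioo_subset_Icc_self hs)]
    exact ⟨Ioo_subset_Icc_self hs, rfl⟩
  have h1 : Tendsto (fun z => dist x z) (𝓝[openSeg x y \ {φ t}] (φ t)) (𝓝[≠] t) := by
    refine tendsto_nhdsWithin_iff.2 ⟨?_, ?_⟩
    · have : ContinuousAt (fun z => dist x z) (φ t) := by fun_prop
      have := this.tendsto
      rw [hd] at this
      exact this.mono_left nhdsWithin_le_nhds
    · filter_upwards [self_mem_nhdsWithin] with z hz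
      intro h
      apply hz.2
      rw [mem_singleton_iff, ← (hmem z hz.1).2, h]
  refine ((hasDerivAt_iff_tendsto_slope.1 hD).comp h1).abs.congr' ?_
  filter_upwards [self_mem_nhdsWithin] with z hz
  obtain ⟨h2, h3⟩ := hmem z hz.1
  have h4 := hφ.2.2 _ h2 _ ht'
  rw [h3] at h4
  simp only [Function.comp, slope_def_field]
  rw [h3, abs_div, h4]

variable (hX : IsLocalTree X (fun _ => r)) {f : X → ℝ}
  (hf : ∀ (x y : X) (φ : ℝ → X), dist x y < r → IsGeodesic x y φ → LipschitzWith 1 φ →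
    AbsolutelyContinuousOnInterval (fun t => f (φ t)) 0 (dist x y))
include hX hf

theorem ae_radialDeriv {x y : X} {φ : ℝ → X} (hxy : dist x y < r) (hφ : IsGeodesic x y φ)
    (hL : LipschitzWith 1 φ) : ∀ᵐ t ∂volume.restrict (Ioo 0 (dist x y)),
      HasDerivAt (fun s => f (φ s)) (radialDeriv f x (φ t)) t := by
  rw [ae_restrict_iff' measurableSet_Ioo]
  filter_upwards [(hf x y φ hxy hφ hL).ae_differentiableAt] with t h ht
  rw [uIcc_of_le dist_nonneg] at h
  have := (h (Ioo_subset_Icc_self ht)).hasDerivAt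
  rwa [radialDeriv_eq hX hxy hφ ht this]

variable [MeasurableSpace X] [BorelSpace X]

/-- On one segment the radial derivative is a.e. a measurable function of the distance to `x`. -/
theorem aestronglyMeasurable_radialDeriv_openSeg {x y : X} (hxy : dist x y < r) :
    AEStronglyMeasurable (radialDeriv f x)
      ((lengthMeasure (fun _ => r)).restrict (openSeg x y)) := by
  obtain ⟨φ, hφ, hL⟩ := hX.exists_isGeodesic hxy
  have hm : Measurable fun z : X => deriv (fun s => f (φ s)) (dist x z) :=
    (measurable_deriv _).comp (by fun_prop)
  refine hm.aemeasurable.aestronglyMeasurable.congr ?_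
  rw [Filter.EventuallyEq, hX.ae_openSeg_iff hxy hφ]
  filter_upwards [ae_radialDeriv hX hf hxy hφ hL, ae_restrict_mem measurableSet_Ioo] with t h ht
  rw [hφ.dist_left (Ioo_subset_Icc_self ht), h.deriv]

theorem ae_tendsto_slope_openSeg {x y : X} (hxy : dist x y < r) :
    ∀ᵐ z ∂(lengthMeasure (fun _ => r)).restrict (openSeg x y),
      Tendsto (fun w => |f w - f z| / dist w z) (𝓝[openSeg x y \ {z}] z)
        (𝓝 |radialDeriv f x z|) := by
  obtain ⟨φ, hφ, hL⟩ := hX.exists_isGeodesic hxy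
  rw [hX.ae_openSeg_iff hxy hφ]
  filter_upwards [ae_radialDeriv hX hf hxy hφ hL, ae_restrict_mem measurableSet_Ioo] with t h ht
  exact tendsto_slope_openSeg hX hxy hφ ht h

variable [TopologicalSpace.SeparableSpace X]

theorem isWeakGradientAt_radialDeriv (x : X) :
    IsWeakGradientAt (fun _ => r) f x (radialDeriv f x) := by
  refine ⟨?_, ?_⟩
  · obtain ⟨u, hu, hle⟩ := hX.restrict_ball_le x
    refine AEStronglyMeasurable.mono_measure ?_ hle
    exact aestronglyMeasurable_iUnion_iff.2 fun n =>
      aestronglyMeasurable_radialDeriv_openSeg hX hf (hu n)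
  · intro u hu
    have hxu : dist x u < r := by rwa [dist_comm]
    obtain ⟨φ, hφ, hL⟩ := hX.exists_isGeodesic hxu
    have hm := aestronglyMeasurable_radialDeriv_openSeg hX hf hxu
    have hac := hf x u φ hxu hφ hL
    have hae := ae_radialDeriv hX hf hxu hφ hL
    have he : (fun t => radialDeriv f x (φ t)) =ᵐ[volume.restrict (Ioo 0 (dist x u))]
        deriv (fun s => f (φ s)) := by
      filter_upwards [hae] with t ht
      rw [ht.deriv]
    rw [hX.integrableOn_openSeg_iff hxu hφ hL hm, hX.integral_openSeg hxu hφ hL hm,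
      integral_congr_ae he, IntegrableOn, integrable_congr he]
    refine ⟨(intervalIntegrable_iff_integrableOn_Ioo_of_le dist_nonneg).1
      hac.intervalIntegrable_deriv, ?_⟩
    rw [← integral_Ioc_eq_integral_Ioo, ← intervalIntegral.integral_of_le dist_nonneg,
      hac.integral_deriv_eq_sub, hφ.1, hφ.2.1]

/-- At a non-isolated point of the intersection of a segment from `x` and one from `y`, both moduli
are limits of the same slopes along that intersection. The isolated points are countable, hence
null. -/
theorem ae_abs_radialDeriv_eq (x y : X) : ∀ᵐ z ∂(lengthMeasure (fun _ => r)),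
    z ∈ Metric.ball x r → z ∈ Metric.ball y r → |radialDeriv f x z| = |radialDeriv f y z| := by
  have : SecondCountableTopology X := UniformSpace.secondCountable_of_separable X
  obtain ⟨u, hu, hlu⟩ := hX.restrict_ball_le x
  obtain ⟨v, hv, hlv⟩ := hX.restrict_ball_le y
  have key : ∀ n k, ∀ᵐ z ∂(lengthMeasure (fun _ => r)), z ∈ openSeg x (u n) →
      z ∈ openSeg y (v k) → |radialDeriv f x z| = |radialDeriv f y z| := by
    intro n k
    have h1 := (ae_restrict_iff' (hX.measurableSet_openSeg (hu n))).1
      (ae_tendsto_slope_openSeg hX hf (hu n))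
    have h2 := (ae_restrict_iff' (hX.measurableSet_openSeg (hv k))).1
      (ae_tendsto_slope_openSeg hX hf (hv k))
    have h3 := (countable_setOf_isolated (openSeg x (u n) ∩ openSeg y (v k))).ae_notMem
      (lengthMeasure (fun _ : X => r))
    filter_upwards [h1, h2, h3] with z a1 a2 a3 b1 b2
    have hne : (𝓝[(openSeg x (u n) ∩ openSeg y (v k)) \ {z}] z).NeBot :=
      ⟨fun h => a3 ⟨⟨b1, b2⟩, h⟩⟩
    refine tendsto_nhds_unique (l := 𝓝[(openSeg x (u n) ∩ openSeg y (v k)) \ {z}] z) ((a1 b1).mono_left (nhdsWithin_mono _ ?_))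
      ((a2 b2).mono_left (nhdsWithin_mono _ ?_))
    · exact sdiff_subset_sdiff_left inter_subset_left
    · exact sdiff_subset_sdiff_left inter_subset_right
  have hmu : MeasurableSet (⋃ n, openSeg x (u n)) :=
    MeasurableSet.iUnion fun n => hX.measurableSet_openSeg (hu n)
  have hmv : MeasurableSet (⋃ n, openSeg y (v n)) :=
    MeasurableSet.iUnion fun n => hX.measurableSet_openSeg (hv n)
  have hU := (ae_restrict_iff' Metric.isOpen_ball.measurableSet).1
    (ae_mono hlu (ae_restrict_mem hmu))
  have hV := (ae_restrict_iff' Metric.isOpen_ball.measurableSet).1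
    (ae_mono hlv (ae_restrict_mem hmv))
  filter_upwards [ae_all_iff.2 fun n => ae_all_iff.2 fun k => key n k, hU, hV] with z hz h1 h2 a b
  obtain ⟨n, hn⟩ := mem_iUnion.1 (h1 a)
  obtain ⟨k, hk⟩ := mem_iUnion.1 (h2 b)
  exact hz n k hn hk

/-- A continuous function which is absolutely continuous along geodesics has a gradient modulus. -/
theorem exists_isGradientModulus (hfc : Continuous f) :
    ∃ G : X → ℝ, IsGradientModulus (fun _ => r) f G := by
  classical
  rcases isEmpty_or_nonempty X with h | h
  · refine ⟨0, ⟨hfc, fun x => h.elim x⟩, ?_, fun x => h.elim x⟩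
    exact aestronglyMeasurable_const
  have hr := (hX (Classical.arbitrary X)).1
  let c := TopologicalSpace.denseSeq X
  have hc : ∀ z, ∃ n, z ∈ Metric.ball (c n) r := fun z => by
    obtain ⟨n, hn⟩ := (TopologicalSpace.denseRange_denseSeq X).exists_dist_lt z hr
    exact ⟨n, hn⟩
  -- Glue the local moduli: use the first ball of a countable cover that contains `z`.
  let G : X → ℝ := fun z => |radialDeriv f (c (Nat.find (hc z))) z|
  have hG : ∀ x, ∀ᵐ z ∂(lengthMeasure (fun _ => r)).restrict (Metric.ball x r),
      G z = |radialDeriv f x z| := by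
    intro x
    rw [ae_restrict_iff' Metric.isOpen_ball.measurableSet]
    filter_upwards [ae_all_iff.2 fun n => ae_abs_radialDeriv_eq hX hf (c n) x] with z hz hzx
    exact hz _ (Nat.find_spec (hc z)) hzx
  have hw := isWeakGradientAt_radialDeriv hX hf
  refine ⟨G, ⟨hfc, fun x => ⟨_, hw x⟩⟩, ?_, fun x => ⟨_, hw x, hG x⟩⟩
  have hun : (⋃ n, Metric.ball (c n) r) = univ :=
    eq_univ_of_forall fun z => mem_iUnion.2 (hc z)
  rw [← Measure.restrict_univ (μ := lengthMeasure (fun _ : X => r)), ← hun,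
    aestronglyMeasurable_iUnion_iff]
  intro n
  have hm : AEStronglyMeasurable (fun z => |radialDeriv f (c n) z|)
      ((lengthMeasure (fun _ => r)).restrict (Metric.ball (c n) r)) := (hw (c n)).1.norm
  exact hm.congr ((hG (c n)).mono fun z hz => hz.symm)

end Construction

/-! ### Jensen's inequality for averages. -/

section Average

variable {X : Type*} [MeasurableSpace X]

theorem enorm_average_sub_rpow_le {m : Measure X} {p : ℝ} (hp : 1 < p) {f : X → ℝ} {A : Set X}
    (hA0 : m A ≠ 0) (hA : m A ≠ ⊤) (hf : IntegrableOn f A m) (c : ℝ) :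
    ‖(⨍ y in A, f y ∂m) - c‖ₑ ^ p ≤ (m A)⁻¹ * ∫⁻ y in A, ‖f y - c‖ₑ ^ p ∂m := by
  have : IsFiniteMeasure (m.restrict A) := ⟨by simpa using hA.lt_top⟩
  have : NeZero (m.restrict A) := ⟨by simpa [Measure.restrict_eq_zero] using hA0⟩
  have huniv : ((m.restrict A) univ)⁻¹ = (m A)⁻¹ := by rw [Measure.restrict_apply_univ]
  have e : (⨍ y in A, f y ∂m) - c = ∫ y, (f y - c) ∂(((m.restrict A) univ)⁻¹ • m.restrict A) := by
    rw [integral_sub, integral_const]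
    · simp [average, measureReal_def, ENNReal.inv_mul_cancel hA0 hA]
    · exact Integrable.smul_measure hf (by simpa using hA0)
    · exact integrable_const _
  calc ‖(⨍ y in A, f y ∂m) - c‖ₑ ^ p
      ≤ (∫⁻ y, ‖f y - c‖ₑ ∂(((m.restrict A) univ)⁻¹ • m.restrict A)) ^ p := by
        rw [e]
        gcongr
        exact enorm_integral_le_lintegral_enorm _
    _ ≤ 1 ^ (p - 1) * ∫⁻ y, ‖f y - c‖ₑ ^ p ∂(((m.restrict A) univ)⁻¹ • m.restrict A) := by
        have h1 : (((m.restrict A) univ)⁻¹ • m.restrict A) univ = 1 := by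
          simp [ENNReal.inv_mul_cancel hA0 hA]
        rw [← h1]
        refine rpow_lintegral_le _ hp ?_
        exact ((hf.aestronglyMeasurable.sub aestronglyMeasurable_const).enorm).smul_measure _
    _ = _ := by rw [ENNReal.one_rpow, one_mul, lintegral_smul_measure, huniv, smul_eq_mul]

theorem integrableOn_of_memLp {m : Measure X} {p : ℝ} (hp : 1 < p) {f : X → ℝ}
    (hf : MemLp f (ENNReal.ofReal p) m) {A : Set X} (hA : m A ≠ ⊤) : IntegrableOn f A m := by
  have : IsFiniteMeasure (m.restrict A) := ⟨by simpa using hA.lt_top⟩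
  exact (hf.restrict A).integrable (by simpa using hp.le)

end Average

/-! ### Averages over nearby balls and the local energy. -/

section Energy

variable {X : Type*} [MetricSpace X] [MeasurableSpace X]

/-- The integrand of the Korevaar–Schoen energy at scale `r`. -/
def localEnergy (m : Measure X) (p : ℝ) (f : X → ℝ) (r : ℝ) (x : X) : ℝ≥0∞ :=
  (m (Metric.ball x r))⁻¹ * ∫⁻ y in Metric.ball x r, ‖f y - f x‖ₑ ^ p ∂m

theorem scaling_pos {Φ : ℝ → ℝ} {r₀ : ℝ} (hΦ : IsVolumeProfile Φ r₀) (p : ℝ) {r : ℝ}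
    (hr : 0 < r) (hr₀ : r ≤ r₀) : 0 < scaling p Φ r :=
  mul_pos (Real.rpow_pos_of_pos hr _) (hΦ.pos r ⟨hr, hr₀⟩)

theorem lintegral_localEnergy {m : Measure X} {p : ℝ} {Ψ : ℝ → ℝ} (f : X → ℝ) {r : ℝ}
    (hr : 0 < Ψ r) :
    ∫⁻ x, localEnergy m p f r x ∂m = ENNReal.ofReal (Ψ r) * ksEnergy m p Ψ f r := by
  rw [ksEnergy, ← mul_assoc, ENNReal.mul_inv_cancel (by simpa using hr) ENNReal.ofReal_ne_top,
    one_mul]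
  rfl

theorem ksEnergy_congr {m : Measure X} {p : ℝ} {Ψ : ℝ → ℝ} {f g : X → ℝ} (h : f =ᵐ[m] g)
    (r : ℝ) : ksEnergy m p Ψ f r = ksEnergy m p Ψ g r := by
  unfold ksEnergy
  congr 1
  refine lintegral_congr_ae ?_
  filter_upwards [h] with x hx
  congr 1
  refine lintegral_congr_ae ?_
  filter_upwards [ae_restrict_of_ae h] with y hy
  rw [hx, hy]

/-- Averages of `f` over nearby balls of radius about `ε` are controlled by the local energy at
scale `4ε`. -/
def AverageBound (m : Measure X) (p : ℝ) (Φ : ℝ → ℝ) (r₀ K : ℝ) : Prop :=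
  ∀ (f : X → ℝ) (x z : X) (ε a b : ℝ), MemLp f (ENNReal.ofReal p) m → 0 < ε → 4 * ε < r₀ →
    a ∈ Icc (ε / 2) ε → b ∈ Icc (ε / 2) ε → dist x z ≤ ε →
    ‖(⨍ y in Metric.ball x a, f y ∂m) - ⨍ y in Metric.ball z b, f y ∂m‖ₑ ^ p ≤
      ENNReal.ofReal K * (ENNReal.ofReal (Φ (4 * ε)))⁻¹ *
        ∫⁻ w in Metric.ball x ε, localEnergy m p f (4 * ε) w ∂m

variable {m : Measure X} {Φ : ℝ → ℝ} {r₀ : ℝ}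

theorem UniformVolumeControl.ne_zero_ne_top (hΦ : IsVolumeProfile Φ r₀)
    (hm : UniformVolumeControl m Φ r₀) (x : X) {r : ℝ} (hr : 0 < r) (hr₀ : r < r₀) :
    m (Metric.ball x r) ≠ 0 ∧ m (Metric.ball x r) ≠ ⊤ := by
  obtain ⟨c, C, hc, hC, h⟩ := hm
  obtain ⟨h1, h2⟩ := h x r hr hr₀
  refine ⟨fun h0 => ?_, (h2.trans_lt ENNReal.ofReal_lt_top).ne⟩
  rw [h0, nonpos_iff_eq_zero, ENNReal.ofReal_eq_zero] at h1
  exact absurd h1 (not_le.2 (mul_pos hc (hΦ.pos r ⟨hr, hr₀.le⟩)))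

/-- Jensen is applied in each of the two averages, and all balls in play sit inside `B(w, 4ε)` for
`w` in the first ball. -/
theorem exists_averageBound (hΦ : IsVolumeProfile Φ r₀) [OpensMeasurableSpace X]
    (hm : UniformVolumeControl m Φ r₀) {p : ℝ} (hp : 1 < p) : ∃ K, 0 < K ∧ AverageBound m p Φ r₀ K := by
  have hfin := fun (x : X) (r : ℝ) (h : 0 < r) (h' : r < r₀) =>
    hm.ne_zero_ne_top hΦ x h h'
  obtain ⟨c₂, C₂, hc₂, hC₂, hball⟩ := hm
  obtain ⟨c₁, C₁, α, -, hC₁, hα, hratio⟩ := hΦ.ratio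
  -- The two averages cost `1 / (c₂ Φ(ε/2))` each and the local energy costs `C₂ Φ(4ε)`. Trading
  -- `Φ(ε/2)` for `Φ(4ε)` uses the ratio `8 = 4ε / (ε/2)` twice.
  refine ⟨C₂ * (C₁ * 8 ^ α) ^ 2 / c₂ ^ 2, by positivity, ?_⟩
  intro f x z ε a b hf hε hε₀ ha hb hxz
  have hε2 : 0 < Φ (ε / 2) := hΦ.pos _ ⟨by linarith, by linarith⟩
  have hε4 : 0 < Φ (4 * ε) := hΦ.pos _ ⟨by linarith, by linarith⟩
  have hrat : Φ (4 * ε) / Φ (ε / 2) ≤ C₁ * 8 ^ α := by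
    have := (hratio (ε / 2) (4 * ε) (by linarith) (by linarith) (by linarith)).2
    rwa [show 4 * ε / (ε / 2) = 8 by field_simp; norm_num] at this
  have ha0 : 0 < a := by linarith [ha.1]
  have hb0 : 0 < b := by linarith [hb.1]
  obtain ⟨xa0, xat⟩ := hfin x a ha0 (by linarith [ha.2])
  obtain ⟨zb0, zbt⟩ := hfin z b hb0 (by linarith [hb.2])
  have low : ∀ (y : X) (s : ℝ), ε / 2 ≤ s →
      (m (Metric.ball y s))⁻¹ ≤ (ENNReal.ofReal (c₂ * Φ (ε / 2)))⁻¹ := fun y s hs =>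
    ENNReal.inv_le_inv.2 ((hball y (ε / 2) (by linarith) (by linarith)).1.trans
      (measure_mono (Metric.ball_subset_ball hs)))
  set q := (ENNReal.ofReal (c₂ * Φ (ε / 2)))⁻¹ with hq
  have inner : ∀ w ∈ Metric.ball x a, ‖f w - ⨍ y in Metric.ball z b, f y ∂m‖ₑ ^ p ≤
      q * ENNReal.ofReal (C₂ * Φ (4 * ε)) * localEnergy m p f (4 * ε) w := by
    intro w hw
    obtain ⟨w0, wt⟩ := hfin w (4 * ε) (by linarith) hε₀
    rw [← enorm_neg, neg_sub]
    refine (enorm_average_sub_rpow_le hp zb0 zbt (integrableOn_of_memLp hp hf zbt) _).trans ?_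
    have hsub : Metric.ball z b ⊆ Metric.ball w (4 * ε) := by
      refine Metric.ball_subset_ball' ?_
      have h1 := dist_triangle z x w
      have h2 := dist_comm x z
      have h3 : dist w x < a := hw
      have h4 := dist_comm x w
      linarith [hb.2, ha.2]
    calc (m (Metric.ball z b))⁻¹ * ∫⁻ y in Metric.ball z b, ‖f y - f w‖ₑ ^ p ∂m
        ≤ q * ∫⁻ y in Metric.ball w (4 * ε), ‖f y - f w‖ₑ ^ p ∂m := by
          gcongr
          exact low z b hb.1
      _ = q * (m (Metric.ball w (4 * ε)) * localEnergy m p f (4 * ε) w) := by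
          rw [localEnergy, ← mul_assoc (m _), ENNReal.mul_inv_cancel w0 wt, one_mul]
      _ ≤ q * (ENNReal.ofReal (C₂ * Φ (4 * ε)) * localEnergy m p f (4 * ε) w) := by
          gcongr
          exact (hball w (4 * ε) (by linarith) hε₀).2
      _ = _ := by rw [mul_assoc]
  calc ‖(⨍ y in Metric.ball x a, f y ∂m) - ⨍ y in Metric.ball z b, f y ∂m‖ₑ ^ p
      ≤ (m (Metric.ball x a))⁻¹ *
          ∫⁻ w in Metric.ball x a, ‖f w - ⨍ y in Metric.ball z b, f y ∂m‖ₑ ^ p ∂m :=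
        enorm_average_sub_rpow_le hp xa0 xat (integrableOn_of_memLp hp hf xat) _
    _ ≤ q * ∫⁻ w in Metric.ball x a,
          q * ENNReal.ofReal (C₂ * Φ (4 * ε)) * localEnergy m p f (4 * ε) w ∂m := by
        gcongr 1
        · exact low x a ha.1
        · exact setLIntegral_mono' Metric.isOpen_ball.measurableSet inner
    _ ≤ q * (q * ENNReal.ofReal (C₂ * Φ (4 * ε)) *
          ∫⁻ w in Metric.ball x ε, localEnergy m p f (4 * ε) w ∂m) := by
        rw [lintegral_const_mul' _ _ (ENNReal.mul_ne_top
          (ENNReal.inv_ne_top.2 (by simpa using mul_pos hc₂ hε2)) ENNReal.ofReal_ne_top)]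
        gcongr
        exact ha.2
    _ ≤ _ := by
        rw [← mul_assoc]
        refine mul_le_mul' ?_ le_rfl
        rw [hq, ← ENNReal.ofReal_inv_of_pos (mul_pos hc₂ hε2), ← ENNReal.ofReal_inv_of_pos hε4,
          ← ENNReal.ofReal_mul (by positivity), ← ENNReal.ofReal_mul (by positivity),
          ← ENNReal.ofReal_mul (by positivity)]
        refine ENNReal.ofReal_le_ofReal ?_
        have h2 : (Φ (4 * ε) / Φ (ε / 2)) ^ 2 ≤ (C₁ * 8 ^ α) ^ 2 := by gcongr
        calc (c₂ * Φ (ε / 2))⁻¹ * ((c₂ * Φ (ε / 2))⁻¹ * (C₂ * Φ (4 * ε)))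
            = C₂ / c₂ ^ 2 * (Φ (4 * ε) / Φ (ε / 2)) ^ 2 * (Φ (4 * ε))⁻¹ := by field_simp
          _ ≤ C₂ / c₂ ^ 2 * (C₁ * 8 ^ α) ^ 2 * (Φ (4 * ε))⁻¹ := by gcongr
          _ = _ := by ring

/-- Integrating the local energy over all of `X` cancels `Φ(4ε)` and leaves `(4ε)^(p-1)`, which
tends to `0` because `p > 1`. -/
theorem AverageBound.le_ksEnergy {p K : ℝ} (hK : AverageBound m p Φ r₀ K)
    (hΦ : IsVolumeProfile Φ r₀) {f : X → ℝ} (hf : MemLp f (ENNReal.ofReal p) m) {x z : X}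
    {ε a b : ℝ} (hε : 0 < ε) (hε₀ : 4 * ε < r₀) (ha : a ∈ Icc (ε / 2) ε) (hb : b ∈ Icc (ε / 2) ε)
    (hxz : dist x z ≤ ε) :
    ‖(⨍ y in Metric.ball x a, f y ∂m) - ⨍ y in Metric.ball z b, f y ∂m‖ₑ ^ p ≤
      ENNReal.ofReal K * ENNReal.ofReal ((4 * ε) ^ (p - 1)) *
        ksEnergy m p (scaling p Φ) f (4 * ε) := by
  have hpos := hΦ.pos (4 * ε) ⟨by linarith, hε₀.le⟩
  refine (hK f x z ε a b hf hε hε₀ ha hb hxz).trans ?_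
  rw [mul_assoc, mul_assoc]
  refine mul_le_mul' le_rfl ((mul_le_mul' le_rfl (setLIntegral_le_lintegral _ _)).trans
    (le_of_eq ?_))
  rw [lintegral_localEnergy (Ψ := scaling p Φ) f (scaling_pos hΦ p (by linarith) hε₀.le),
    ← mul_assoc, scaling, mul_comm (_ ^ _), ENNReal.ofReal_mul hpos.le, ← mul_assoc,
    ENNReal.inv_mul_cancel (by simpa using hpos) ENNReal.ofReal_ne_top, one_mul]

end Energy

/-! ### Measurability, Tonelli over moving balls, and the bound of the energy by the gradient. -/

section EnergyMeasurable

variable {X : Type*} [MetricSpace X] [MeasurableSpace X] [BorelSpace X]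
  [SecondCountableTopology X] {m : Measure X} [SFinite m] {Φ : ℝ → ℝ} {r₀ : ℝ}

theorem measurableSet_dist_lt (r : ℝ) : MeasurableSet {q : X × X | dist q.2 q.1 < r} :=
  measurableSet_lt (by fun_prop) measurable_const

theorem measurable_lintegral_ball {F : X → X → ℝ≥0∞} (hF : Measurable (Function.uncurry F))
    (r : ℝ) : Measurable fun x => ∫⁻ y in Metric.ball x r, F x y ∂m := by
  have : (fun x => ∫⁻ y in Metric.ball x r, F x y ∂m) = fun x =>
      ∫⁻ y, {q : X × X | dist q.2 q.1 < r}.indicator (Function.uncurry F) (x, y) ∂m := by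
    ext x
    rw [← lintegral_indicator Metric.isOpen_ball.measurableSet]
    rfl
  rw [this]
  exact (hF.indicator (measurableSet_dist_lt r)).lintegral_prod_right'

theorem measurable_measure_ball (r : ℝ) : Measurable fun x => m (Metric.ball x r) := by
  have := measurable_lintegral_ball (m := m) (F := fun _ _ => 1) measurable_const r
  simpa using this

theorem measurable_localEnergy {f : X → ℝ} (hf : Measurable f) (p r : ℝ) :
    Measurable (localEnergy m p f r) := by
  refine (measurable_measure_ball r).inv.mul (measurable_lintegral_ball ?_ r)
  unfold Function.uncurry
  fun_prop

theorem measurable_average_ball {f : X → ℝ} (hf : Measurable f) (r : ℝ) :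
    Measurable fun x => ⨍ y in Metric.ball x r, f y ∂m := by
  have e : (fun x => ⨍ y in Metric.ball x r, f y ∂m) = fun x =>
      (m (Metric.ball x r)).toReal⁻¹ * ∫ y,
        {q : X × X | dist q.2 q.1 < r}.indicator (fun q => f q.2) (x, y) ∂m := by
    ext x
    rw [setAverage_eq, ← integral_indicator Metric.isOpen_ball.measurableSet, smul_eq_mul]
    rfl
  rw [e]
  refine (measurable_measure_ball r).ennreal_toReal.inv.mul ?_
  have : StronglyMeasurable ({q : X × X | dist q.2 q.1 < r}.indicator (fun q => f q.2)) :=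
    ((hf.comp measurable_snd).indicator (measurableSet_dist_lt r)).stronglyMeasurable
  exact this.integral_prod_right'.measurable

/-- Tonelli for integrals over balls with moving centres. -/
theorem lintegral_lintegral_ball {μ : Measure X} [SFinite μ] {F : X → ℝ≥0∞}
    (hF : AEMeasurable F μ) (r : ℝ) :
    ∫⁻ x, ∫⁻ z in Metric.ball x r, F z ∂μ ∂m = ∫⁻ z, m (Metric.ball z r) * F z ∂μ := by
  have h1 : ∀ x, ∫⁻ z in Metric.ball x r, F z ∂μ =
      ∫⁻ z, {q : X × X | dist q.2 q.1 < r}.indicator (fun q => F q.2) (x, z) ∂μ := fun x => by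
    rw [← lintegral_indicator Metric.isOpen_ball.measurableSet]
    rfl
  simp_rw [h1]
  rw [lintegral_lintegral_swap]
  · refine lintegral_congr fun z => ?_
    have : (fun x => {q : X × X | dist q.2 q.1 < r}.indicator (fun q => F q.2) (x, z)) =
        (Metric.ball z r).indicator (fun _ => F z) := by
      ext x
      simp only [indicator, mem_ofPred_eq, Metric.mem_ball, dist_comm]
    rw [this, lintegral_indicator Metric.isOpen_ball.measurableSet, setLIntegral_const, mul_comm]
  · exact (hF.comp_snd).indicator (measurableSet_dist_lt r)

/-- The energy at every small scale is controlled by the gradient. -/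
theorem IsGradientModulus.ksEnergy_le {ι₀ : ℝ} (hX : IsLocalTree X (fun _ => ι₀))
    (hΦ : IsVolumeProfile Φ r₀) {C : ℝ} (hC : 0 < C)
    (hm : ∀ (x : X) (r : ℝ), 0 < r → r < r₀ → m (Metric.ball x r) ≤ ENNReal.ofReal (C * Φ r))
    {p : ℝ} (hp : 1 < p) {f G : X → ℝ} (hG : IsGradientModulus (fun _ => ι₀) f G) {r : ℝ}
    (hr : 0 < r) (hr₀ : r < r₀) (hrι : r ≤ ι₀) :
    ksEnergy m p (scaling p Φ) f r ≤
      ENNReal.ofReal C * ∫⁻ z, ‖G z‖ₑ ^ p ∂lengthMeasure (fun _ => ι₀) := by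
  have := hX.sFinite_lengthMeasure
  have hΦr := hΦ.pos r ⟨hr, hr₀.le⟩
  have hsc : 0 < r ^ (p - 1) := Real.rpow_pos_of_pos hr _
  have hGm : AEMeasurable (fun z => ‖G z‖ₑ ^ p) (lengthMeasure (fun _ : X => ι₀)) :=
    hG.2.1.enorm.pow_const p
  have h1 : ∀ x, localEnergy m p f r x ≤ ENNReal.ofReal (r ^ (p - 1)) *
      ∫⁻ z in Metric.ball x r, ‖G z‖ₑ ^ p ∂lengthMeasure (fun _ => ι₀) := by
    intro x
    set B := ENNReal.ofReal (r ^ (p - 1)) *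
      ∫⁻ z in Metric.ball x r, ‖G z‖ₑ ^ p ∂lengthMeasure (fun _ => ι₀)
    have h2 : ∀ y ∈ Metric.ball x r, ‖f y - f x‖ₑ ^ p ≤ B := by
      intro y hy
      have hxy : dist x y < r := by rwa [dist_comm]
      refine (hG.enorm_sub_rpow_le hX hp (hxy.trans_le hrι)).trans ?_
      rw [ENNReal.ofReal_rpow_of_nonneg dist_nonneg (by linarith)]
      refine mul_le_mul' (ENNReal.ofReal_le_ofReal ?_) ?_
      · exact Real.rpow_le_rpow dist_nonneg hxy.le (by linarith)
      · exact lintegral_mono_set ((hX.openSeg_subset_ball (hxy.trans_le hrι)).trans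
          (Metric.ball_subset_ball hxy.le))
    calc localEnergy m p f r x ≤ (m (Metric.ball x r))⁻¹ * ∫⁻ y in Metric.ball x r, B ∂m := by
          rw [localEnergy]
          gcongr 1
          exact setLIntegral_mono' Metric.isOpen_ball.measurableSet h2
      _ = (m (Metric.ball x r))⁻¹ * m (Metric.ball x r) * B := by
          rw [setLIntegral_const]
          ring
      _ ≤ 1 * B := by
          gcongr
          exact ENNReal.inv_mul_le_one _
      _ = B := one_mul B
  calc ksEnergy m p (scaling p Φ) f r
      ≤ (ENNReal.ofReal (scaling p Φ r))⁻¹ * ∫⁻ x, ENNReal.ofReal (r ^ (p - 1)) *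
          ∫⁻ z in Metric.ball x r, ‖G z‖ₑ ^ p ∂lengthMeasure (fun _ => ι₀) ∂m := by
        exact mul_le_mul' le_rfl (lintegral_mono h1)
    _ = (ENNReal.ofReal (scaling p Φ r))⁻¹ * (ENNReal.ofReal (r ^ (p - 1)) *
          ∫⁻ z, m (Metric.ball z r) * ‖G z‖ₑ ^ p ∂lengthMeasure (fun _ => ι₀)) := by
        rw [lintegral_const_mul' _ _ ENNReal.ofReal_ne_top, lintegral_lintegral_ball hGm]
    _ ≤ (ENNReal.ofReal (scaling p Φ r))⁻¹ * (ENNReal.ofReal (r ^ (p - 1)) *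
          ∫⁻ z, ENNReal.ofReal (C * Φ r) * ‖G z‖ₑ ^ p ∂lengthMeasure (fun _ => ι₀)) := by
        gcongr with z
        exact hm z r hr hr₀
    _ = _ := by
        rw [lintegral_const_mul' _ _ ENNReal.ofReal_ne_top, ← mul_assoc, ← mul_assoc, scaling,
          ← ENNReal.ofReal_inv_of_pos (by positivity), ← ENNReal.ofReal_mul (by positivity),
          ← ENNReal.ofReal_mul (by positivity)]
        congr 2
        field_simp

end EnergyMeasurable

/-! ### The continuous representative. -/

theorem abs_le_rpow_of_enorm_rpow_le {p : ℝ} (hp : 0 < p) {u B : ℝ} (hB : 0 ≤ B)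
    (h : ‖u‖ₑ ^ p ≤ ENNReal.ofReal B) : |u| ≤ B ^ (1 / p) := by
  rw [← ofReal_norm, ENNReal.ofReal_rpow_of_nonneg (norm_nonneg _) hp.le,
    ENNReal.ofReal_le_ofReal_iff hB, Real.norm_eq_abs] at h
  rw [one_div]
  exact (Real.le_rpow_inv_iff_of_pos (abs_nonneg u) hB hp).2 h

section Representative

variable {X : Type*} [MetricSpace X] [MeasurableSpace X] {m : Measure X} {Φ : ℝ → ℝ} {r₀ : ℝ}

theorem lintegral_average_sub_rpow_le (hΦ : IsVolumeProfile Φ r₀)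
    (hm : UniformVolumeControl m Φ r₀) {p : ℝ} (hp : 1 < p) {f : X → ℝ}
    (hf : MemLp f (ENNReal.ofReal p) m) {r : ℝ} (hr : 0 < r) (hr₀ : r < r₀) :
    ∫⁻ x, ‖(⨍ y in Metric.ball x r, f y ∂m) - f x‖ₑ ^ p ∂m ≤
      ENNReal.ofReal (scaling p Φ r) * ksEnergy m p (scaling p Φ) f r := by
  rw [← lintegral_localEnergy f (scaling_pos hΦ p hr hr₀.le)]
  refine lintegral_mono fun x => ?_
  obtain ⟨h0, ht⟩ := hm.ne_zero_ne_top hΦ x hr hr₀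
  exact enorm_average_sub_rpow_le hp h0 ht (integrableOn_of_memLp hp hf ht) _

variable [BorelSpace X] [SecondCountableTopology X] [SFinite m]

/-- A function whose energies are bounded at small scales has a continuous representative. -/
theorem exists_continuous_ae_eq (hΦ : IsVolumeProfile Φ r₀) (hm : UniformVolumeControl m Φ r₀)
    {p : ℝ} (hp : 1 < p) {K : ℝ} (hK0 : 0 < K) (hK : AverageBound m p Φ r₀ K) {f : X → ℝ}
    (hfm : Measurable f) (hf : MemLp f (ENNReal.ofReal p) m) {ρ₀ M : ℝ} (hρ₀ : 0 < ρ₀)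
    (hρr : ρ₀ ≤ r₀) (hM0 : 0 ≤ M)
    (hM : ∀ r, 0 < r → r < ρ₀ → ksEnergy m p (scaling p Φ) f r ≤ ENNReal.ofReal M) :
    ∃ F : X → ℝ, Continuous F ∧ f =ᵐ[m] F := by
  have hp0 : 0 < p := by linarith
  -- The `8` keeps the energy scale `4 ε k` below `ρ₀`; the ratio `q` below is `2^(-(p-1)/p)`, less
  -- than `1` because `p > 1`.
  set ε : ℕ → ℝ := fun k => ρ₀ / 8 * (1 / 2) ^ k with hε
  have hεpos : ∀ k, 0 < ε k := fun k => by positivity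
  have hεle : ∀ k, ε k ≤ ρ₀ / 8 := fun k =>
    mul_le_of_le_one_right (by positivity) (pow_le_one₀ (by norm_num) (by norm_num))
  have hεs : ∀ k, ε (k + 1) = ε k / 2 := fun k => by simp only [hε, pow_succ]; ring
  set D : ℝ := (K * (ρ₀ / 2) ^ (p - 1) * M) ^ (1 / p) with hD
  set q : ℝ := ((1 / 2 : ℝ) ^ (p - 1)) ^ (1 / p) with hq
  have hq0 : 0 ≤ q := by positivity
  have hq1 : q < 1 := Real.rpow_lt_one (by positivity)
    (Real.rpow_lt_one (by norm_num) (by norm_num) (by linarith)) (by positivity)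
  have hD0 : 0 ≤ D := by positivity
  set A : ℕ → X → ℝ := fun k x => ⨍ y in Metric.ball x (ε k), f y ∂m with hA
  -- Letting the radii vary covers two uses: consecutive scales at one centre (convergence) and
  -- equal scales at nearby centres (continuity).
  have key : ∀ k x z a b, a ∈ Icc (ε k / 2) (ε k) → b ∈ Icc (ε k / 2) (ε k) → dist x z ≤ ε k →
      |(⨍ y in Metric.ball x a, f y ∂m) - ⨍ y in Metric.ball z b, f y ∂m| ≤ D * q ^ k := by
    intro k x z a b ha hb hxz
    have h4 : 4 * ε k < ρ₀ := by linarith [hεle k]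
    have h := hK.le_ksEnergy hΦ hf (hεpos k) (h4.trans_le hρr) ha hb hxz
    have h' := h.trans (mul_le_mul' le_rfl (hM _ (by linarith [hεpos k]) h4))
    rw [← ENNReal.ofReal_mul hK0.le, ← ENNReal.ofReal_mul
      (mul_nonneg hK0.le (Real.rpow_nonneg (by linarith [hεpos k]) _))] at h'
    have h'' := abs_le_rpow_of_enorm_rpow_le hp0 (mul_nonneg (mul_nonneg hK0.le
      (Real.rpow_nonneg (by linarith [hεpos k]) _)) hM0) h'
    refine h''.trans (le_of_eq ?_)
    have e1 : (4 * ε k) ^ (p - 1) = (ρ₀ / 2) ^ (p - 1) * ((1 / 2 : ℝ) ^ (p - 1)) ^ k := by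
      rw [← Real.rpow_natCast ((1 / 2 : ℝ) ^ (p - 1)), ← Real.rpow_mul (by norm_num),
        mul_comm (p - 1), Real.rpow_mul (by norm_num), Real.rpow_natCast,
        ← Real.mul_rpow (by positivity) (by positivity)]
      congr 1
      simp only [hε]
      ring
    have e2 : (((1 / 2 : ℝ) ^ (p - 1)) ^ k) ^ (1 / p) = q ^ k :=
      (Real.rpow_pow_comm (by positivity) _ _).symm
    rw [e1, hD, ← e2, ← Real.mul_rpow (by positivity) (by positivity)]
    congr 1
    ring
  have step : ∀ x k, dist (A k x) (A (k + 1) x) ≤ D * q ^ k := fun x k => by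
    rw [Real.dist_eq]
    exact key k x x _ _ ⟨by linarith [hεpos k], le_rfl⟩
      (by rw [hεs]; exact ⟨le_rfl, by linarith [hεpos k]⟩) (by rw [dist_self]; exact (hεpos k).le)
  have hlim : ∀ x, ∃ l, Tendsto (fun k => A k x) atTop (𝓝 l) := fun x =>
    cauchySeq_tendsto_of_complete (cauchySeq_of_le_geometric q D hq1 (step x))
  choose F hF using hlim
  have hAF : ∀ x k, dist (A k x) (F x) ≤ D * q ^ k / (1 - q) := fun x k =>
    dist_le_of_le_geometric_of_tendsto q D hq1 (step x) (hF x) k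
  refine ⟨F, ?_, ?_⟩
  · rw [Metric.continuous_iff]
    intro x e he
    have ht : Tendsto (fun k => D * q ^ k / (1 - q) + D * q ^ k + D * q ^ k / (1 - q)) atTop
        (𝓝 (D * 0 / (1 - q) + D * 0 + D * 0 / (1 - q))) := by
      have := tendsto_pow_atTop_nhds_zero_of_lt_one hq0 hq1
      exact (((this.const_mul D).div_const _).add (this.const_mul D)).add
        ((this.const_mul D).div_const _)
    obtain ⟨k, hk⟩ := (ht.eventually_lt_const (u := e) (by simpa using he)).exists
    refine ⟨ε k, hεpos k, fun z hz => lt_of_le_of_lt ?_ hk⟩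
    refine (dist_triangle4 (F z) (A k z) (A k x) (F x)).trans ?_
    refine add_le_add (add_le_add ?_ ?_) (hAF x k)
    · rw [dist_comm]
      exact hAF z k
    · rw [Real.dist_eq]
      exact key k z x _ _ ⟨by linarith [hεpos k], le_rfl⟩ ⟨by linarith [hεpos k], le_rfl⟩ hz.le
  · have hFm : Measurable F := measurable_of_tendsto_metrizable
      (fun k => measurable_average_ball hfm (ε k)) (tendsto_pi_nhds.2 hF)
    -- Fatou: the averages converge to `F` pointwise and to `f` in `L^p`, as `scaling p Φ (ε k) →
    -- 0`.
    have h0 : ∫⁻ x, ‖F x - f x‖ₑ ^ p ∂m = 0 := by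
      rw [← nonpos_iff_eq_zero]
      calc ∫⁻ x, ‖F x - f x‖ₑ ^ p ∂m
          = ∫⁻ x, liminf (fun k => ‖A k x - f x‖ₑ ^ p) atTop ∂m := by
            refine lintegral_congr fun x => ?_
            exact (((hF x).sub_const (f x)).enorm.ennrpow_const p).liminf_eq.symm
        _ ≤ liminf (fun k => ∫⁻ x, ‖A k x - f x‖ₑ ^ p ∂m) atTop := by
            refine lintegral_liminf_le fun k => ?_
            exact ((measurable_average_ball hfm (ε k)).sub hfm).enorm.pow_const p
        _ ≤ liminf (fun k => ENNReal.ofReal (ε k ^ (p - 1) * Φ r₀ * M)) atTop := by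
            refine liminf_le_liminf (Eventually.of_forall fun k => ?_)
            have hk : ε k < ρ₀ := by linarith [hεle k]
            refine (lintegral_average_sub_rpow_le hΦ hm hp hf (hεpos k)
              (hk.trans_le hρr)).trans ?_
            rw [ENNReal.ofReal_mul' hM0]
            refine mul_le_mul' (ENNReal.ofReal_le_ofReal ?_) (hM _ (hεpos k) hk)
            refine mul_le_mul_of_nonneg_left ?_ (Real.rpow_nonneg (hεpos k).le _)
            exact hΦ.monotone ⟨(hεpos k).le, by linarith⟩ ⟨by linarith, le_rfl⟩ (by linarith)
        _ = 0 := by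
            have h1 : Tendsto ε atTop (𝓝 0) := by
              have := (tendsto_pow_atTop_nhds_zero_of_lt_one (r := (1 / 2 : ℝ)) (by norm_num)
                (by norm_num)).const_mul (ρ₀ / 8)
              rwa [mul_zero] at this
            have h2 : Tendsto (fun k => ε k ^ (p - 1)) atTop (𝓝 0) := by
              have := h1.rpow_const (p := p - 1) (Or.inr (by linarith))
              rwa [Real.zero_rpow (by linarith)] at this
            have h3 := ENNReal.tendsto_ofReal ((h2.mul_const (Φ r₀)).mul_const M)
            simpa using h3.liminf_eq
    have h0 := (lintegral_eq_zero_iff (f := fun x => ‖F x - f x‖ₑ ^ p)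
      ((hFm.sub hfm).enorm.pow_const p)).1 h0
    filter_upwards [h0] with x hx
    simp only [Pi.zero_apply, ENNReal.rpow_eq_zero_iff, enorm_eq_zero, hp0, and_true] at hx
    rcases hx with hx | hx
    · linarith
    · exact absurd hx.2 (by linarith)

end Representative

/-! ### Chaining increments, and Fatou for sums. -/

section Real

/-- An increment over `[t, t + h]` is controlled by `k` increments of length `h / k`. -/
theorem lintegral_enorm_increment_le {p : ℝ} (hp : 1 ≤ p) {g : ℝ → ℝ} (hg : Measurable g)
    {J J' : Set ℝ} (hJ : MeasurableSet J) (hJ' : MeasurableSet J') {h : ℝ} (hh : 0 ≤ h)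
    (hJJ : ∀ t ∈ J, ∀ u ∈ Icc 0 h, t + u ∈ J') {k : ℕ} (hk : 0 < k) :
    ∫⁻ t in J, ‖g (t + h) - g t‖ₑ ^ p ≤
      (k : ℝ≥0∞) ^ p * ∫⁻ s in J', ‖g (s + h / k) - g s‖ₑ ^ p := by
  set η := h / k with hη
  have hk' : (0 : ℝ) < k := Nat.cast_pos.2 hk
  have hkη : k * η = h := by rw [hη]; field_simp
  have hη0 : 0 ≤ η := by positivity
  set b : ℝ → ℝ≥0∞ := fun s => ‖g (s + η) - g s‖ₑ ^ p with hb
  have hbm : Measurable b := by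
    simp only [hb]
    fun_prop
  have pt : ∀ t, ‖g (t + h) - g t‖ₑ ^ p ≤
      (k : ℝ≥0∞) ^ (p - 1) * ∑ j ∈ Finset.range k, b (t + j * η) := by
    intro t
    have e : g (t + h) - g t = ∑ j ∈ Finset.range k, (g (t + j * η + η) - g (t + j * η)) := by
      have := Finset.sum_range_sub (fun j : ℕ => g (t + j * η)) k
      simp only [hkη, Nat.cast_zero, zero_mul, add_zero] at this
      rw [← this]
      refine Finset.sum_congr rfl fun j _ => ?_
      push_cast
      congr 2
      ring
    calc ‖g (t + h) - g t‖ₑ ^ p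
        ≤ (∑ j ∈ Finset.range k, ‖g (t + j * η + η) - g (t + j * η)‖ₑ) ^ p := by
          rw [e]
          gcongr
          exact enorm_sum_le _ _
      _ ≤ _ := by
          have := ENNReal.rpow_sum_le_const_mul_sum_rpow (s := Finset.range k)
            (f := fun j : ℕ => ‖g (t + j * η + η) - g (t + j * η)‖ₑ) hp
          rwa [Finset.card_range] at this
  -- Each of the `k` shifted integrals is bounded by the whole integral over `J'`; with `k^(p-1)`
  -- from convexity this gives `k^p`.
  have tr : ∀ j ∈ Finset.range k, ∫⁻ t in J, b (t + j * η) ≤ ∫⁻ s in J', b s := by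
    intro j hj
    have hj' : (j : ℝ) ≤ k := Nat.cast_le.2 (Finset.mem_range.1 hj).le
    rw [← lintegral_indicator hJ, ← lintegral_indicator hJ',
      ← lintegral_add_right_eq_self (J'.indicator b) ((j : ℝ) * η)]
    refine lintegral_mono fun t => ?_
    by_cases ht : t ∈ J
    · rw [indicator_of_mem ht, indicator_of_mem (hJJ t ht (j * η) ⟨by positivity, by
        rw [← hkη]; exact mul_le_mul_of_nonneg_right hj' hη0⟩)]
    · rw [indicator_of_notMem ht]
      exact zero_le
  calc ∫⁻ t in J, ‖g (t + h) - g t‖ₑ ^ p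
      ≤ ∫⁻ t in J, (k : ℝ≥0∞) ^ (p - 1) * ∑ j ∈ Finset.range k, b (t + j * η) :=
        lintegral_mono pt
    _ = (k : ℝ≥0∞) ^ (p - 1) * ∑ j ∈ Finset.range k, ∫⁻ t in J, b (t + j * η) := by
        rw [lintegral_const_mul' _ _ (ENNReal.rpow_ne_top_of_nonneg (by linarith)
          (ENNReal.natCast_ne_top k)), lintegral_finsetSum]
        intro j _
        exact hbm.comp (by fun_prop)
    _ ≤ (k : ℝ≥0∞) ^ (p - 1) * ∑ j ∈ Finset.range k, ∫⁻ s in J', b s := by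
        exact mul_le_mul' le_rfl (Finset.sum_le_sum tr)
    _ = _ := by
        rw [Finset.sum_const, Finset.card_range, nsmul_eq_mul, ← mul_assoc]
        congr 1
        nth_rewrite 2 [← ENNReal.rpow_one (k : ℝ≥0∞)]
        rw [← ENNReal.rpow_add _ _ (by exact_mod_cast hk.ne') (ENNReal.natCast_ne_top k)]
        congr 1
        ring

/-- Fatou for the counting measure. -/
theorem tsum_liminf_le {κ β : Type*} {u : Filter β} [u.IsCountablyGenerated]
    (a : β → κ → ℝ≥0∞) :
    ∑' i, liminf (fun n => a n i) u ≤ liminf (fun n => ∑' i, a n i) u := by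
  let _ : MeasurableSpace κ := ⊤
  simp_rw [← lintegral_count]
  exact lintegral_liminf_le fun n => Measurable.of_discrete

end Real

/-! ### Increments of averages at one scale, summed over separated geodesics. -/

section Scale

variable {X : Type*} [MetricSpace X]

/-- The parameter set has diameter at most `2ε`, since `φ` is isometric, and volume on the line is
at most diameter. -/
theorem IsGeodesic.volume_ball_le {x y : X} {φ : ℝ → X} (hφ : IsGeodesic x y φ) {J : Set ℝ}
    (hJ : J ⊆ Icc 0 (dist x y)) (w : X) (ε : ℝ) :
    volume {t | t ∈ J ∧ dist (φ t) w < ε} ≤ ENNReal.ofReal (2 * ε) := by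
  refine (Real.volume_le_diam _).trans (Metric.ediam_le fun s hs t ht => ?_)
  rw [edist_dist, Real.dist_eq, ← hφ.2.2 s (hJ hs.1) t (hJ ht.1)]
  refine ENNReal.ofReal_le_ofReal ?_
  have := dist_triangle_right (φ s) (φ t) w
  linarith [hs.2, ht.2]

variable [MeasurableSpace X] [BorelSpace X] {N : ℕ} {x y : Fin N → X} {φ : Fin N → ℝ → X} {J : Fin N → Set ℝ}

/-- The images under the geodesics `φ i` of the sets `J i` are at mutual distance `≥ δ`. -/
def Separated (φ : Fin N → ℝ → X) (J : Fin N → Set ℝ) (δ : ℝ) : Prop :=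
  ∀ i j, i ≠ j → ∀ s ∈ J i, ∀ t ∈ J j, δ ≤ dist (φ i s) (φ j t)

variable (hφ : ∀ i, IsGeodesic (x i) (y i) (φ i)) (hL : ∀ i, LipschitzWith 1 (φ i))
  (hJ : ∀ i, J i ⊆ Icc 0 (dist (x i) (y i))) (hJm : ∀ i, MeasurableSet (J i))
include hφ hL hJ hJm

/-- By separation an `ε`-ball meets at most one piece. Hence the bound does not depend on `N`. -/
theorem sum_map_ball_le {ε : ℝ} (hsep : Separated φ J (2 * ε)) (w : X) :
    Measure.sum (fun i => (volume.restrict (J i)).map (φ i)) (Metric.ball w ε) ≤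
      ENNReal.ofReal (2 * ε) := by
  rw [Measure.sum_apply _ Metric.isOpen_ball.measurableSet, tsum_fintype]
  have e : ∀ i, (volume.restrict (J i)).map (φ i) (Metric.ball w ε) =
      volume {t | t ∈ J i ∧ dist (φ i t) w < ε} := fun i => by
    rw [Measure.map_apply (hL i).continuous.measurable Metric.isOpen_ball.measurableSet,
      Measure.restrict_apply' (hJm i), inter_comm]
    rfl
  simp_rw [e]
  by_cases h : ∃ i, ∃ t ∈ J i, dist (φ i t) w < ε
  · obtain ⟨i, t, ht, hti⟩ := h
    rw [Finset.sum_eq_single_of_mem i (Finset.mem_univ i)]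
    · exact (hφ i).volume_ball_le (hJ i) w ε
    · intro j _ hji
      have : {s | s ∈ J j ∧ dist (φ j s) w < ε} = ∅ := by
        refine eq_empty_of_forall_notMem fun s hs => ?_
        have h1 := hsep j i hji s hs.1 t ht
        have h2 := dist_triangle_right (φ j s) (φ i t) w
        linarith [hs.2]
      rw [this, measure_empty]
  · push Not at h
    rw [Finset.sum_eq_zero]
    · exact zero_le
    · intro i _
      have : {s | s ∈ J i ∧ dist (φ i s) w < ε} = ∅ :=
        eq_empty_of_forall_notMem fun s hs => absurd hs.2 (not_lt.2 (h i s hs.1))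
      rw [this, measure_empty]

variable [SecondCountableTopology X] {m : Measure X} [SFinite m]

theorem tsum_lintegral_ball_le {ε : ℝ} (hsep : Separated φ J (2 * ε)) {e : X → ℝ≥0∞}
    (he : Measurable e) :
    ∑' i, ∫⁻ t in J i, ∫⁻ w in Metric.ball (φ i t) ε, e w ∂m ≤
      ENNReal.ofReal (2 * ε) * ∫⁻ w, e w ∂m := by
  have h1 : ∑' i, ∫⁻ t in J i, ∫⁻ w in Metric.ball (φ i t) ε, e w ∂m =
      ∫⁻ z, ∫⁻ w in Metric.ball z ε, e w ∂m
        ∂Measure.sum (fun i => (volume.restrict (J i)).map (φ i)) := by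
    rw [lintegral_sum_measure]
    refine tsum_congr fun i => ?_
    rw [lintegral_map _ (hL i).continuous.measurable]
    exact measurable_lintegral_ball (F := fun _ => e) (he.comp measurable_snd) ε
  rw [h1, lintegral_lintegral_ball he.aemeasurable, ← lintegral_const_mul _ he]
  gcongr with w
  exact sum_map_ball_le hφ hL hJ hJm hsep w

variable {Φ : ℝ → ℝ} {r₀ p K : ℝ} (hΦ : IsVolumeProfile Φ r₀) (hK0 : 0 < K)
  (hK : AverageBound m p Φ r₀ K) {f : X → ℝ} (hfm : Measurable f)
  (hf : MemLp f (ENNReal.ofReal p) m)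
include hΦ hK0 hK hfm hf

/-- Tonelli contributes `2ε` and the scaling `(4ε)^(p-1)`: together the power `ε^p` that a chain of
order `h/ε` steps can compensate. -/
theorem tsum_lintegral_average_le {ε η : ℝ} (hε : 0 < ε) (hε₀ : 4 * ε < r₀) (hη : 0 ≤ η)
    (hηε : η ≤ ε) (hsep : Separated φ J (2 * ε)) :
    ∑' i, ∫⁻ s in J i, ‖(⨍ y in Metric.ball (φ i (s + η)) ε, f y ∂m) -
        ⨍ y in Metric.ball (φ i s) ε, f y ∂m‖ₑ ^ p ≤
      ENNReal.ofReal (2 * K * ε * (4 * ε) ^ (p - 1)) *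
        ksEnergy m p (scaling p Φ) f (4 * ε) := by
  have hpos := hΦ.pos (4 * ε) ⟨by linarith, hε₀.le⟩
  set q := ENNReal.ofReal K * (ENNReal.ofReal (Φ (4 * ε)))⁻¹ with hq
  have hqt : q ≠ ⊤ := ENNReal.mul_ne_top ENNReal.ofReal_ne_top
    (ENNReal.inv_ne_top.2 (by simpa using hpos))
  have hem : Measurable (localEnergy m p f (4 * ε)) := measurable_localEnergy hfm p _
  calc _ ≤ ∑' i, ∫⁻ s in J i, q *
          ∫⁻ w in Metric.ball (φ i s) ε, localEnergy m p f (4 * ε) w ∂m := by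
        refine ENNReal.tsum_le_tsum fun i => lintegral_mono fun s => ?_
        rw [← enorm_neg, neg_sub]
        refine hK f _ _ ε ε ε hf hε hε₀ ⟨by linarith, le_rfl⟩ ⟨by linarith, le_rfl⟩ ?_
        have := (hL i).dist_le_mul s (s + η)
        simp only [NNReal.coe_one, one_mul, Real.dist_eq, sub_add_cancel_left, abs_neg,
          abs_of_nonneg hη] at this
        exact this.trans hηε
    _ = q * ∑' i, ∫⁻ s in J i,
          ∫⁻ w in Metric.ball (φ i s) ε, localEnergy m p f (4 * ε) w ∂m := by
        simp_rw [lintegral_const_mul' _ _ hqt]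
        rw [ENNReal.tsum_mul_left]
    _ ≤ q * (ENNReal.ofReal (2 * ε) * ∫⁻ w, localEnergy m p f (4 * ε) w ∂m) := by
        gcongr
        exact tsum_lintegral_ball_le hφ hL hJ hJm hsep hem
    _ = _ := by
        rw [lintegral_localEnergy (Ψ := scaling p Φ) f (scaling_pos hΦ p (by linarith) hε₀.le),
          ← mul_assoc, ← mul_assoc, hq, scaling, ← ENNReal.ofReal_inv_of_pos hpos,
          ← ENNReal.ofReal_mul hK0.le, ← ENNReal.ofReal_mul (by positivity),
          ← ENNReal.ofReal_mul (by positivity)]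
        congr 2
        field_simp

end Scale

/-! ### Letting the averaging scale tend to zero. -/

section Limit

variable {X : Type*} [MetricSpace X] [MeasurableSpace X] {m : Measure X}

theorem tendsto_average_ball [OpensMeasurableSpace X] {Φ : ℝ → ℝ} {r₀ : ℝ}
    (hΦ : IsVolumeProfile Φ r₀)
    (hm : UniformVolumeControl m Φ r₀) {p : ℝ} (hp : 1 < p) {f : X → ℝ} (hfc : Continuous f)
    (hf : MemLp f (ENNReal.ofReal p) m) (x : X) :
    Tendsto (fun ε => ⨍ y in Metric.ball x ε, f y ∂m) (𝓝[>] 0) (𝓝 (f x)) := by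
  rw [Metric.tendsto_nhds]
  intro e he
  obtain ⟨δ, hδ, hδf⟩ := Metric.continuous_iff.1 hfc x (e / 2) (by positivity)
  have hr₀ := hΦ.radius_pos
  filter_upwards [Ioo_mem_nhdsGT (lt_min hδ hr₀)] with ε hε
  rw [mem_Ioo, lt_min_iff] at hε
  obtain ⟨h0, ht⟩ := hm.ne_zero_ne_top hΦ x hε.1 hε.2.2
  have : (⨍ y in Metric.ball x ε, f y ∂m) ∈ Metric.closedBall (f x) (e / 2) := by
    refine (convex_closedBall _ _).set_average_mem Metric.isClosed_closedBall h0 ht ?_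
      (integrableOn_of_memLp hp hf ht)
    filter_upwards [ae_restrict_mem Metric.isOpen_ball.measurableSet] with y hy
    exact (hδf y ((Metric.mem_ball.1 hy).trans hε.2.1)).le
  exact lt_of_le_of_lt this (by linarith)

theorem liminf_comp_const_mul {E : ℝ → ℝ≥0∞} {c : ℝ} (hc : 0 < c) :
    liminf (fun ε => E (c * ε)) (𝓝[>] 0) = liminf E (𝓝[>] 0) := by
  have : map (fun ε : ℝ => c * ε) (𝓝[>] 0) = 𝓝[>] 0 := by
    have h := (Homeomorph.mulLeft₀ c hc.ne').isEmbedding.map_nhdsWithin_eq (Ioi 0) 0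
    have e : (Homeomorph.mulLeft₀ c hc.ne') '' Ioi (0 : ℝ) = Ioi 0 := by
      ext t
      constructor
      · rintro ⟨s, hs, rfl⟩
        exact mul_pos hc hs
      · intro ht
        exact ⟨t / c, div_pos ht hc, by simp [mul_div_cancel₀ _ hc.ne']⟩
    rw [e] at h
    simpa using h
  nth_rewrite 2 [← this]
  rfl

variable [BorelSpace X] [SecondCountableTopology X] [SFinite m] {N : ℕ} {x y : Fin N → X}
  {φ : Fin N → ℝ → X} {S J : Fin N → Set ℝ} {Φ : ℝ → ℝ} {r₀ p K : ℝ}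

theorem tsum_lintegral_average_increment_le (hφ : ∀ i, IsGeodesic (x i) (y i) (φ i))
    (hL : ∀ i, LipschitzWith 1 (φ i)) (hΦ : IsVolumeProfile Φ r₀) (hp : 1 < p) (hK0 : 0 < K)
    (hK : AverageBound m p Φ r₀ K) {f : X → ℝ} (hfm : Measurable f)
    (hf : MemLp f (ENNReal.ofReal p) m) (hSm : ∀ i, MeasurableSet (S i))
    (hJm : ∀ i, MeasurableSet (J i)) (hJ : ∀ i, J i ⊆ Icc 0 (dist (x i) (y i))) {h δ : ℝ}
    (hh : 0 < h) (hSJ : ∀ i, ∀ t ∈ S i, ∀ u ∈ Icc 0 h, t + u ∈ J i) (hsep : Separated φ J δ)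
    {ε : ℝ} (hε : 0 < ε) (hε₀ : 4 * ε < r₀) (hεh : ε ≤ h) (hεδ : 2 * ε ≤ δ) :
    ∑' i, ∫⁻ t in S i, ‖(⨍ y in Metric.ball (φ i (t + h)) ε, f y ∂m) -
        ⨍ y in Metric.ball (φ i t) ε, f y ∂m‖ₑ ^ p ≤
      ENNReal.ofReal (2 * 2 ^ p * 4 ^ (p - 1) * K * h ^ p) *
        ksEnergy m p (scaling p Φ) f (4 * ε) := by
  -- Enough steps for each to have length at most `ε`; since `ε ≤ h`, still `k ≤ 2h/ε`, so that `k^p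
  -- ε^p` is of order `h^p`.
  set k := ⌈h / ε⌉₊ with hk
  have hk0 : 0 < k := Nat.ceil_pos.2 (by positivity)
  have hk0' : (0 : ℝ) < k := Nat.cast_pos.2 hk0
  have hk1 : h / ε ≤ k := Nat.le_ceil _
  have hk2 : (k : ℝ) ≤ 2 * h / ε := by
    have h1 := (Nat.ceil_lt_add_one (show 0 ≤ h / ε by positivity)).le
    have h2 : 1 ≤ h / ε := (one_le_div hε).2 hεh
    rw [mul_div_assoc]
    linarith
  have hηε : h / k ≤ ε := by
    rw [div_le_iff₀ hk0', mul_comm]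
    rwa [div_le_iff₀ hε] at hk1
  have hsep' : Separated φ J (2 * ε) := fun i j hij s hs t ht =>
    hεδ.trans (hsep i j hij s hs t ht)
  calc _ ≤ ∑' i, (k : ℝ≥0∞) ^ p * ∫⁻ s in J i,
          ‖(⨍ y in Metric.ball (φ i (s + h / k)) ε, f y ∂m) -
            ⨍ y in Metric.ball (φ i s) ε, f y ∂m‖ₑ ^ p := by
        refine ENNReal.tsum_le_tsum fun i => ?_
        exact lintegral_enorm_increment_le
          (g := fun t => ⨍ y in Metric.ball (φ i t) ε, f y ∂m) hp.le
          ((measurable_average_ball hfm ε).comp (hL i).continuous.measurable) (hSm i) (hJm i)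
          hh.le (hSJ i) hk0
    _ ≤ (k : ℝ≥0∞) ^ p * (ENNReal.ofReal (2 * K * ε * (4 * ε) ^ (p - 1)) *
          ksEnergy m p (scaling p Φ) f (4 * ε)) := by
        rw [ENNReal.tsum_mul_left]
        refine mul_le_mul' le_rfl ?_
        exact tsum_lintegral_average_le hφ hL hJ hJm hΦ hK0 hK hfm hf hε hε₀ (by positivity) hηε
          hsep'
    _ ≤ _ := by
        rw [← mul_assoc]
        refine mul_le_mul' ?_ le_rfl
        rw [← ENNReal.ofReal_natCast, ENNReal.ofReal_rpow_of_nonneg hk0'.le (by linarith),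
          ← ENNReal.ofReal_mul (by positivity)]
        refine ENNReal.ofReal_le_ofReal ?_
        have e1 : (2 * h / ε) ^ p = 2 ^ p * h ^ p / ε ^ p := by
          rw [Real.div_rpow (by positivity) hε.le, Real.mul_rpow (by norm_num) hh.le]
        have e2 : ε ^ p = ε ^ (p - 1) * ε := by
          rw [← Real.rpow_add_one hε.ne']
          congr 1
          ring
        have hεp : 0 < ε ^ (p - 1) := Real.rpow_pos_of_pos hε _
        calc (k : ℝ) ^ p * (2 * K * ε * (4 * ε) ^ (p - 1))
            ≤ (2 * h / ε) ^ p * (2 * K * ε * (4 * ε) ^ (p - 1)) := by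
              gcongr
          _ = _ := by
              rw [e1, e2, Real.mul_rpow (by norm_num) hε.le]
              field_simp

/-- With `h` fixed, Fatou in the integrals and in the sum passes from averages to the continuous
`f`. The larger sets `J i` contain the chains that start in `S i`. -/
theorem tsum_lintegral_increment_le (hφ : ∀ i, IsGeodesic (x i) (y i) (φ i))
    (hL : ∀ i, LipschitzWith 1 (φ i)) (hJ : ∀ i, J i ⊆ Icc 0 (dist (x i) (y i)))
    (hJm : ∀ i, MeasurableSet (J i)) (hSm : ∀ i, MeasurableSet (S i))
    (hΦ : IsVolumeProfile Φ r₀) (hm : UniformVolumeControl m Φ r₀) (hp : 1 < p) (hK0 : 0 < K)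
    (hK : AverageBound m p Φ r₀ K) {f : X → ℝ} (hfc : Continuous f)
    (hf : MemLp f (ENNReal.ofReal p) m) {h δ : ℝ} (hh : 0 < h) (hδ : 0 < δ)
    (hSJ : ∀ i, ∀ t ∈ S i, ∀ u ∈ Icc 0 h, t + u ∈ J i) (hsep : Separated φ J δ) :
    ∑' i, ∫⁻ t in S i, ‖f (φ i (t + h)) - f (φ i t)‖ₑ ^ p ≤
      ENNReal.ofReal (2 * 2 ^ p * 4 ^ (p - 1) * K * h ^ p) *
        liminf (fun r => ksEnergy m p (scaling p Φ) f r) (𝓝[>] 0) := by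
  have hr₀ := hΦ.radius_pos
  have hlim := tendsto_average_ball hΦ hm hp hfc hf
  calc ∑' i, ∫⁻ t in S i, ‖f (φ i (t + h)) - f (φ i t)‖ₑ ^ p
      = ∑' i, ∫⁻ t in S i, liminf (fun ε => ‖(⨍ y in Metric.ball (φ i (t + h)) ε, f y ∂m) -
          ⨍ y in Metric.ball (φ i t) ε, f y ∂m‖ₑ ^ p) (𝓝[>] 0) := by
        refine tsum_congr fun i => lintegral_congr fun t => ?_
        exact (((hlim _).sub (hlim _)).enorm.ennrpow_const p).liminf_eq.symm
    _ ≤ ∑' i, liminf (fun ε => ∫⁻ t in S i, ‖(⨍ y in Metric.ball (φ i (t + h)) ε, f y ∂m) -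
          ⨍ y in Metric.ball (φ i t) ε, f y ∂m‖ₑ ^ p) (𝓝[>] 0) := by
        refine ENNReal.tsum_le_tsum fun i => lintegral_liminf_le fun ε => ?_
        have h1 := (measurable_average_ball (m := m) hfc.measurable ε).comp
          (hL i).continuous.measurable
        exact ((h1.comp (measurable_add_const h)).sub h1).enorm.pow_const p
    _ ≤ liminf (fun ε => ∑' i, ∫⁻ t in S i, ‖(⨍ y in Metric.ball (φ i (t + h)) ε, f y ∂m) -
          ⨍ y in Metric.ball (φ i t) ε, f y ∂m‖ₑ ^ p) (𝓝[>] 0) := tsum_liminf_le _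
    _ ≤ liminf (fun ε => ENNReal.ofReal (2 * 2 ^ p * 4 ^ (p - 1) * K * h ^ p) *
          ksEnergy m p (scaling p Φ) f (4 * ε)) (𝓝[>] 0) := by
        refine liminf_le_liminf ?_
        filter_upwards [Ioo_mem_nhdsGT (show 0 < min (r₀ / 4) (min h (δ / 2)) by positivity)]
          with ε hε
        rw [mem_Ioo, lt_min_iff, lt_min_iff] at hε
        exact tsum_lintegral_average_increment_le hφ hL hΦ hp hK0 hK hfc.measurable hf hSm hJm hJ
          hh hSJ hsep hε.1 (by linarith) hε.2.2.1.le (by linarith)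
    _ = _ := by
        rw [ENNReal.liminf_const_mul_of_ne_top ENNReal.ofReal_ne_top,
          liminf_comp_const_mul (E := fun r => ksEnergy m p (scaling p Φ) f r) (by norm_num)]

end Limit

/-! ### Difference quotients bounded in `L^p` imply absolute continuity. -/

section Increments

variable {F : ℝ → ℝ} {p ℓ : ℝ} {M : ℝ≥0∞}

/-- The means of `F` over `[b, b+h]` and `[a, a+h]` differ by `h⁻¹ ∫_a^b (F(t+h) - F(t)) dt`, so
their increments are governed by difference quotients. -/
theorem enorm_increment_average_le (hF : Continuous F) {a b h : ℝ} (hh : 0 < h) :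
    ‖h⁻¹ • ((∫ t in (0 : ℝ)..b + h, F t) - ∫ t in (0 : ℝ)..b, F t) -
        h⁻¹ • ((∫ t in (0 : ℝ)..a + h, F t) - ∫ t in (0 : ℝ)..a, F t)‖ₑ ≤
      ENNReal.ofReal h⁻¹ * ∫⁻ t in uIoc a b, ‖F (t + h) - F t‖ₑ := by
  have hi : ∀ c d : ℝ, IntervalIntegrable F volume c d := fun c d => hF.intervalIntegrable c d
  have e : h⁻¹ • ((∫ t in (0 : ℝ)..b + h, F t) - ∫ t in (0 : ℝ)..b, F t) -
      h⁻¹ • ((∫ t in (0 : ℝ)..a + h, F t) - ∫ t in (0 : ℝ)..a, F t) =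
      h⁻¹ * ∫ t in a..b, (F (t + h) - F t) := by
    rw [intervalIntegral.integral_sub ((by fun_prop : Continuous fun t => F (t + h)).intervalIntegrable
        _ _) (hi _ _),
      intervalIntegral.integral_comp_add_right, ← intervalIntegral.integral_interval_sub_left
        (hi 0 (b + h)) (hi 0 (a + h)), ← intervalIntegral.integral_interval_sub_left
        (hi 0 b) (hi 0 a)]
    simp only [smul_eq_mul]
    ring
  rw [e, enorm_mul]
  refine mul_le_mul' (le_of_eq ?_) ?_
  · rw [Real.enorm_eq_ofReal (by positivity)]
  · rw [← enorm_norm, intervalIntegral.norm_intervalIntegral_eq, enorm_norm]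
    exact enorm_integral_le_lintegral_enorm _

theorem volume_biUnion_uIoc_le (n : ℕ) (I : ℕ → ℝ × ℝ) :
    volume (⋃ i ∈ Finset.range n, uIoc (I i).1 (I i).2) ≤
      ENNReal.ofReal (∑ i ∈ Finset.range n, dist (I i).1 (I i).2) := by
  refine (measure_biUnion_finset_le _ _).trans (le_of_eq ?_)
  rw [ENNReal.ofReal_sum_of_nonneg (fun _ _ => dist_nonneg)]
  refine Finset.sum_congr rfl fun i _ => ?_
  simp [uIoc, Real.dist_eq, max_sub_min_eq_abs']

variable (hF : Continuous F) (hp : 1 < p)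
  (hM : ∀ h, 0 < h → ∫⁻ t in Icc 0 (ℓ - h), ‖F (t + h) - F t‖ₑ ^ p ≤ ENNReal.ofReal (h ^ p) * M)
include hF hp hM

/-- Replace `F` by its means over `[t, t+h]`, use Hölder on the disjoint union of the intervals, and
let `h → 0`. The gap below `ℓ` leaves room for `t + h`. -/
theorem sum_enorm_increment_rpow_le_of_lt {ℓ' : ℝ} (hℓ' : ℓ' < ℓ) {n : ℕ} {I : ℕ → ℝ × ℝ}
    (hI : ∀ i ∈ Finset.range n, (I i).1 ∈ Icc 0 ℓ' ∧ (I i).2 ∈ Icc 0 ℓ')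
    (hd : (Finset.range n : Set ℕ).PairwiseDisjoint fun i => uIoc (I i).1 (I i).2) :
    (∑ i ∈ Finset.range n, ‖F (I i).2 - F (I i).1‖ₑ) ^ p ≤
      ENNReal.ofReal (∑ i ∈ Finset.range n, dist (I i).1 (I i).2) ^ (p - 1) * M := by
  have hder : ∀ t, Tendsto (fun h => h⁻¹ • ((∫ t in (0 : ℝ)..t + h, F t) - ∫ t in (0 : ℝ)..t, F t))
      (𝓝[>] 0) (𝓝 (F t)) := fun t =>
    (hF.integral_hasStrictDerivAt 0 t).hasDerivAt.tendsto_slope_zero_right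
  have hlim : Tendsto (fun h : ℝ => (∑ i ∈ Finset.range n,
      ‖h⁻¹ • ((∫ t in (0 : ℝ)..(I i).2 + h, F t) - ∫ t in (0 : ℝ)..(I i).2, F t) -
        h⁻¹ • ((∫ t in (0 : ℝ)..(I i).1 + h, F t) - ∫ t in (0 : ℝ)..(I i).1, F t)‖ₑ) ^ p)
      (𝓝[>] 0) (𝓝 ((∑ i ∈ Finset.range n, ‖F (I i).2 - F (I i).1‖ₑ) ^ p)) :=
    (tendsto_finsetSum _ fun i _ => ((hder _).sub (hder _)).enorm).ennrpow_const p
  refine le_of_tendsto hlim ?_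
  filter_upwards [Ioo_mem_nhdsGT (show 0 < ℓ - ℓ' by linarith)] with h hh
  set U := ⋃ i ∈ Finset.range n, uIoc (I i).1 (I i).2 with hU
  have hUsub : U ⊆ Icc 0 (ℓ - h) := by
    refine iUnion₂_subset fun i hi t ht => ?_
    obtain ⟨h1, h2⟩ := hI i hi
    rw [mem_uIoc] at ht
    rcases ht with ht | ht
    · exact ⟨by linarith [h1.1], by linarith [h2.2, hh.2]⟩
    · exact ⟨by linarith [h2.1], by linarith [h1.2, hh.2]⟩
  have hh0 := hh.1
  calc _ ≤ (∑ i ∈ Finset.range n,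
          ENNReal.ofReal h⁻¹ * ∫⁻ t in uIoc (I i).1 (I i).2, ‖F (t + h) - F t‖ₑ) ^ p := by
        refine ENNReal.rpow_le_rpow (Finset.sum_le_sum fun i _ => ?_) (by linarith)
        exact enorm_increment_average_le hF hh0
    _ = ENNReal.ofReal h⁻¹ ^ p * (∫⁻ t in U, ‖F (t + h) - F t‖ₑ) ^ p := by
        rw [← Finset.mul_sum, hU, lintegral_biUnion_finset hd fun i _ => measurableSet_uIoc,
          ENNReal.mul_rpow_of_nonneg _ _ (by linarith)]
    _ ≤ ENNReal.ofReal h⁻¹ ^ p * (ENNReal.ofReal (∑ i ∈ Finset.range n,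
          dist (I i).1 (I i).2) ^ (p - 1) * (ENNReal.ofReal (h ^ p) * M)) := by
        refine mul_le_mul' le_rfl ((rpow_lintegral_le _ hp ?_).trans (mul_le_mul' ?_ ?_))
        · exact (by fun_prop : Measurable fun t => ‖F (t + h) - F t‖ₑ).aemeasurable
        · rw [Measure.restrict_apply_univ]
          exact ENNReal.rpow_le_rpow (volume_biUnion_uIoc_le n I) (by linarith)
        · exact (lintegral_mono_set hUsub).trans (hM h hh0)
    _ = _ := by
        have : ENNReal.ofReal h⁻¹ ^ p * ENNReal.ofReal (h ^ p) = 1 := by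
          rw [ENNReal.ofReal_rpow_of_nonneg (by positivity) (by linarith),
            ← ENNReal.ofReal_mul (by positivity), ← Real.mul_rpow (by positivity) hh0.le,
            inv_mul_cancel₀ hh0.ne', Real.one_rpow, ENNReal.ofReal_one]
        rw [mul_left_comm, ← mul_assoc (ENNReal.ofReal h⁻¹ ^ p), this, one_mul]

/-- The end point `ℓ` is reached by shrinking the intervals by a factor `c < 1` and letting `c → 1`.
-/
theorem sum_enorm_increment_rpow_le (hℓ : 0 < ℓ) {n : ℕ} {I : ℕ → ℝ × ℝ}
    (hI : ∀ i ∈ Finset.range n, (I i).1 ∈ Icc 0 ℓ ∧ (I i).2 ∈ Icc 0 ℓ)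
    (hd : (Finset.range n : Set ℕ).PairwiseDisjoint fun i => uIoc (I i).1 (I i).2) :
    (∑ i ∈ Finset.range n, ‖F (I i).2 - F (I i).1‖ₑ) ^ p ≤
      ENNReal.ofReal (∑ i ∈ Finset.range n, dist (I i).1 (I i).2) ^ (p - 1) * M := by
  have hc : ∀ t, Tendsto (fun c : ℝ => F (c * t)) (𝓝[<] 1) (𝓝 (F t)) := fun t => by
    have : ContinuousAt (fun c : ℝ => F (c * t)) 1 := by fun_prop
    have h := this.tendsto
    rw [one_mul] at h
    exact h.mono_left nhdsWithin_le_nhds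
  have hlim : Tendsto (fun c : ℝ => (∑ i ∈ Finset.range n,
      ‖F (c * (I i).2) - F (c * (I i).1)‖ₑ) ^ p)
      (𝓝[<] 1) (𝓝 ((∑ i ∈ Finset.range n, ‖F (I i).2 - F (I i).1‖ₑ) ^ p)) :=
    (tendsto_finsetSum _ fun i _ => ((hc _).sub (hc _)).enorm).ennrpow_const p
  refine le_of_tendsto hlim ?_
  filter_upwards [Ioo_mem_nhdsLT (show (0 : ℝ) < 1 by norm_num)] with c hc
  have h1 : ∀ t ∈ Icc 0 ℓ, c * t ∈ Icc 0 (c * ℓ) := fun t ht =>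
    ⟨mul_nonneg hc.1.le ht.1, mul_le_mul_of_nonneg_left ht.2 hc.1.le⟩
  have h2 : (Finset.range n : Set ℕ).PairwiseDisjoint
      fun i => uIoc (c * (I i).1) (c * (I i).2) := by
    intro i hi j hj hij
    refine disjoint_left.2 fun t hti htj =>
      (Set.disjoint_left.1 (hd hi hj hij) (?_ : t / c ∈ _)) ?_
    · simpa only [mem_uIoc, lt_div_iff₀' hc.1, div_le_iff₀' hc.1] using hti
    · simpa only [mem_uIoc, lt_div_iff₀' hc.1, div_le_iff₀' hc.1] using htj
  have h := sum_enorm_increment_rpow_le_of_lt hF hp hM (mul_lt_of_lt_one_left hℓ hc.2)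
    (n := n) (I := fun i => (c * (I i).1, c * (I i).2))
    (fun i hi => ⟨h1 _ (hI i hi).1, h1 _ (hI i hi).2⟩) h2
  refine h.trans (mul_le_mul' (ENNReal.rpow_le_rpow (ENNReal.ofReal_le_ofReal
    (Finset.sum_le_sum fun i _ => ?_)) (by linarith)) le_rfl)
  rw [Real.dist_eq, Real.dist_eq, ← mul_sub, abs_mul, abs_of_pos hc.1]
  exact mul_le_of_le_one_left (abs_nonneg _) hc.2.le

/-- A continuous function whose difference quotients are bounded in `L^p`, `p > 1`, is absolutely
continuous. -/
theorem absolutelyContinuousOnInterval_of_increment_le (hℓ : 0 ≤ ℓ) (hMt : M ≠ ⊤) :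
    AbsolutelyContinuousOnInterval F 0 ℓ := by
  rw [absolutelyContinuousOnInterval_iff]
  intro e he
  rcases hℓ.eq_or_lt with rfl | hℓ
  · refine ⟨1, one_pos, fun E hE _ => ?_⟩
    rw [Finset.sum_eq_zero]
    · exact he
    · intro i hi
      obtain ⟨h1, h2⟩ := hE.1 i hi
      rw [uIcc_self, mem_singleton_iff] at h1 h2
      rw [h1, h2, dist_self]
  -- Here `p > 1` is essential: a small total length `s` of the intervals must make the bound small.
  have ht : Tendsto (fun s : ℝ => s ^ (p - 1) * M.toReal) (𝓝 0) (𝓝 0) := by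
    have : ContinuousAt (fun s : ℝ => s ^ (p - 1) * M.toReal) 0 :=
      (Real.continuousAt_rpow_const _ _ (Or.inr (by linarith))).mul continuousAt_const
    have h := this.tendsto
    rwa [Real.zero_rpow (by linarith), zero_mul] at h
  obtain ⟨δ, hδ, hδe⟩ := Metric.eventually_nhds_iff.1
    (ht.eventually_lt_const (u := e ^ p) (Real.rpow_pos_of_pos he p))
  refine ⟨δ, hδ, fun E hE hs => ?_⟩
  have h0 : 0 ≤ ∑ i ∈ Finset.range E.1, dist (E.2 i).1 (E.2 i).2 :=
    Finset.sum_nonneg fun _ _ => dist_nonneg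
  have h1 := hδe (y := ∑ i ∈ Finset.range E.1, dist (E.2 i).1 (E.2 i).2)
    (by rwa [Real.dist_eq, sub_zero, abs_of_nonneg h0])
  have hE' := hE.1
  rw [uIcc_of_le hℓ.le] at hE'
  have h2 := sum_enorm_increment_rpow_le hF hp hM hℓ hE' hE.2
  have h3 : 0 ≤ ∑ i ∈ Finset.range E.1, dist (F (E.2 i).1) (F (E.2 i).2) :=
    Finset.sum_nonneg fun _ _ => dist_nonneg
  have h4 : ∑ i ∈ Finset.range E.1, ‖F (E.2 i).2 - F (E.2 i).1‖ₑ =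
      ENNReal.ofReal (∑ i ∈ Finset.range E.1, dist (F (E.2 i).1) (F (E.2 i).2)) := by
    rw [ENNReal.ofReal_sum_of_nonneg fun _ _ => dist_nonneg]
    refine Finset.sum_congr rfl fun i _ => ?_
    rw [dist_comm, dist_eq_norm, ofReal_norm]
  rw [h4, ENNReal.ofReal_rpow_of_nonneg h3 (by linarith),
    ENNReal.ofReal_rpow_of_nonneg h0 (by linarith), ← ENNReal.ofReal_toReal hMt,
    ← ENNReal.ofReal_mul (Real.rpow_nonneg h0 _),
    ENNReal.ofReal_le_ofReal_iff (mul_nonneg (Real.rpow_nonneg h0 _) ENNReal.toReal_nonneg)] at h2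
  exact lt_of_not_ge fun h5 => absurd (Real.rpow_le_rpow he.le h5 (by linarith : 0 ≤ p))
    (not_le.2 (h2.trans_lt h1))

end Increments

/-! ### The bound of the gradient by the lower limit of the energies. -/

theorem exists_isCompact_lt_setLIntegral {g : ℝ → ℝ≥0∞} (hg : ∀ t, g t ≠ ⊤) {T : Set ℝ}
    (hT : MeasurableSet T) {c : ℝ≥0∞} (hc : c < ∫⁻ t in T, g t) :
    ∃ S ⊆ T, IsCompact S ∧ c < ∫⁻ t in S, g t := by
  have := SigmaFinite.withDensity_of_ne_top' (μ := (volume : Measure ℝ)) hg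
  rw [← withDensity_apply _ hT] at hc
  obtain ⟨A, hA, hAT, hcA, hAt⟩ := Measure.exists_subset_measure_lt_top hT hc
  have : IsFiniteMeasure ((volume.withDensity g).restrict A) := ⟨by simpa using hAt⟩
  obtain ⟨S, hSA, hS, hcS⟩ := hA.exists_lt_isCompact (μ := (volume.withDensity g).restrict A)
    (r := c) (by rwa [Measure.restrict_apply_self])
  refine ⟨S, hSA.trans hAT, hS, ?_⟩
  rwa [Measure.restrict_eq_self _ hSA, withDensity_apply _ hS.measurableSet] at hcS

section LowerBound

variable {X : Type*} [MetricSpace X]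

/-- Disjoint compact images are at positive distance `δ`; thickening the parameter sets by less than
`δ/4` keeps distance `δ/2`. The thickenings give room for increments from `S i`. -/
theorem eventually_separated {N : ℕ} {x y : Fin N → X} {φ : Fin N → ℝ → X} {S : Fin N → Set ℝ}
    (hL : ∀ i, LipschitzWith 1 (φ i)) (hS : ∀ i, IsCompact (S i))
    (hSI : ∀ i, S i ⊆ Ioo 0 (dist (x i) (y i)))
    (hd : ∀ i j, i ≠ j → Disjoint (φ i '' S i) (φ j '' S j)) :
    ∃ h₀ > 0, ∃ δ > 0, Separated φ (fun i => Metric.cthickening h₀ (S i)) δ ∧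
      ∀ i, Metric.cthickening h₀ (S i) ⊆ Icc 0 (dist (x i) (y i)) := by
  have h1 : ∀ᶠ δ in 𝓝[>] (0 : ℝ), ∀ i j, i ≠ j → ∀ s ∈ S i, ∀ t ∈ S j,
      δ ≤ dist (φ i s) (φ j t) := by
    refine eventually_all.2 fun i => eventually_all.2 fun j => ?_
    by_cases hij : i = j
    · exact Eventually.of_forall fun δ h => absurd hij h
    obtain ⟨δ, hδ, hdis⟩ := (hd i j hij).exists_thickenings ((hS i).image (hL i).continuous)
      ((hS j).image (hL j).continuous).isClosed
    filter_upwards [Ioo_mem_nhdsGT hδ] with δ' hδ' _ s hs t ht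
    by_contra! hlt
    refine Set.disjoint_left.1 hdis (?_ : φ j t ∈ _) ?_
    · exact Metric.mem_thickening_iff.2 ⟨φ i s, mem_image_of_mem _ hs, by
        rw [dist_comm]; exact hlt.trans hδ'.2⟩
    · exact Metric.self_subset_thickening hδ _ (mem_image_of_mem _ ht)
  have h2 : ∀ᶠ h in 𝓝[>] (0 : ℝ), ∀ i, Metric.cthickening h (S i) ⊆ Ioo 0 (dist (x i) (y i)) := by
    refine eventually_all.2 fun i => ?_
    obtain ⟨δ, hδ, hsub⟩ := (hS i).exists_cthickening_subset_open isOpen_Ioo (hSI i)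
    filter_upwards [Ioo_mem_nhdsGT hδ] with h hh
    exact (Metric.cthickening_mono hh.2.le _).trans hsub
  obtain ⟨δ, hδ, hδ0⟩ := (h1.and self_mem_nhdsWithin).exists
  obtain ⟨h, hh, hh0, hhδ⟩ := (h2.and (Ioo_mem_nhdsGT (show 0 < δ / 4 from by
    have : 0 < δ := hδ0
    positivity))).exists
  have hδ0' : 0 < δ := hδ0
  refine ⟨h, hh0, δ / 2, by positivity, ?_, fun i => (hh i).trans Ioo_subset_Icc_self⟩
  intro i j hij s hs t ht
  change s ∈ Metric.cthickening h (S i) at hs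
  change t ∈ Metric.cthickening h (S j) at ht
  rw [(hS i).cthickening_eq_biUnion_closedBall hh0.le] at hs
  rw [(hS j).cthickening_eq_biUnion_closedBall hh0.le] at ht
  obtain ⟨s', hs', hss⟩ := mem_iUnion₂.1 hs
  obtain ⟨t', ht', htt⟩ := mem_iUnion₂.1 ht
  have e1 := (hL i).dist_le_mul s s'
  have e2 := (hL j).dist_le_mul t t'
  simp only [NNReal.coe_one, one_mul] at e1 e2
  have e3 := hδ i j hij s' hs' t' ht'
  have e4 := dist_triangle4 (φ i s') (φ i s) (φ j t) (φ j t')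
  have e5 : dist s s' ≤ h := hss
  have e6 : dist t t' ≤ h := htt
  rw [dist_comm (φ i s') (φ i s)] at e4
  linarith

variable [MeasurableSpace X] [BorelSpace X] [SecondCountableTopology X] {m : Measure X} [SFinite m]
  {Φ : ℝ → ℝ} {r₀ p K : ℝ}

/-- A function of finite energy is absolutely continuous along geodesics. -/
theorem absolutelyContinuousOnInterval_geodesic (hΦ : IsVolumeProfile Φ r₀)
    (hm : UniformVolumeControl m Φ r₀) (hp : 1 < p) (hK0 : 0 < K)
    (hK : AverageBound m p Φ r₀ K) {f : X → ℝ} (hfc : Continuous f)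
    (hf : MemLp f (ENNReal.ofReal p) m)
    (hE : liminf (fun r => ksEnergy m p (scaling p Φ) f r) (𝓝[>] 0) ≠ ⊤) {x y : X} {φ : ℝ → X}
    (hφ : IsGeodesic x y φ) (hL : LipschitzWith 1 φ) :
    AbsolutelyContinuousOnInterval (fun t => f (φ t)) 0 (dist x y) := by
  refine absolutelyContinuousOnInterval_of_increment_le (hfc.comp hL.continuous) hp
    (M := ENNReal.ofReal (2 * 2 ^ p * 4 ^ (p - 1) * K) *
      liminf (fun r => ksEnergy m p (scaling p Φ) f r) (𝓝[>] 0)) ?_ dist_nonneg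
    (ENNReal.mul_ne_top ENNReal.ofReal_ne_top hE)
  intro h hh
  -- For a single geodesic, separation is vacuous and the full parameter interval can be used.
  have := tsum_lintegral_increment_le (N := 1) (x := fun _ => x) (y := fun _ => y)
    (φ := fun _ => φ) (S := fun _ => Icc 0 (dist x y - h)) (J := fun _ => Icc 0 (dist x y))
    (δ := 1) (fun _ => hφ) (fun _ => hL) (fun _ => Subset.rfl) (fun _ => measurableSet_Icc)
    (fun _ => measurableSet_Icc) hΦ hm hp hK0 hK hfc hf hh one_pos
    (fun _ t ht u hu => ⟨by linarith [ht.1, hu.1], by linarith [ht.2, hu.2]⟩)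
    (fun i j hij => absurd (Subsingleton.elim i j) hij)
  rw [tsum_fintype, Fin.sum_univ_one] at this
  rwa [← mul_assoc, ← ENNReal.ofReal_mul (by positivity), mul_comm (h ^ p)]

/-- Fatou as `h → 0`: the factor `h^p` of the increment estimate cancels the quotient, and the
constant depends neither on `N` nor on the separation. -/
theorem tsum_lintegral_deriv_le {N : ℕ} {x y : Fin N → X} {φ : Fin N → ℝ → X}
    {S : Fin N → Set ℝ} (hφ : ∀ i, IsGeodesic (x i) (y i) (φ i))
    (hL : ∀ i, LipschitzWith 1 (φ i)) (hS : ∀ i, IsCompact (S i))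
    (hSI : ∀ i, S i ⊆ Ioo 0 (dist (x i) (y i)))
    (hd : ∀ i j, i ≠ j → Disjoint (φ i '' S i) (φ j '' S j)) (hΦ : IsVolumeProfile Φ r₀)
    (hm : UniformVolumeControl m Φ r₀) (hp : 1 < p) (hK0 : 0 < K)
    (hK : AverageBound m p Φ r₀ K) {f : X → ℝ} (hfc : Continuous f)
    (hf : MemLp f (ENNReal.ofReal p) m)
    (hderiv : ∀ i, ∀ᵐ t ∂volume.restrict (S i),
      HasDerivAt (fun s => f (φ i s)) (deriv (fun s => f (φ i s)) t) t) :
    ∑' i, ∫⁻ t in S i, ‖deriv (fun s => f (φ i s)) t‖ₑ ^ p ≤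
      ENNReal.ofReal (2 * 2 ^ p * 4 ^ (p - 1) * K) *
        liminf (fun r => ksEnergy m p (scaling p Φ) f r) (𝓝[>] 0) := by
  obtain ⟨h₀, hh₀, δ, hδ, hsep, hJ⟩ := eventually_separated (x := x) (y := y) hL hS hSI hd
  have hp0 : 0 ≤ p := by linarith
  set B := ENNReal.ofReal (2 * 2 ^ p * 4 ^ (p - 1) * K) *
        liminf (fun r => ksEnergy m p (scaling p Φ) f r) (𝓝[>] 0) with hB
  have hfm : ∀ i, Measurable fun t => f (φ i t) := fun i =>
    (hfc.comp (hL i).continuous).measurable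
  calc ∑' i, ∫⁻ t in S i, ‖deriv (fun s => f (φ i s)) t‖ₑ ^ p
      = ∑' i, ∫⁻ t in S i, liminf (fun h : ℝ =>
          ‖h⁻¹ • (f (φ i (t + h)) - f (φ i t))‖ₑ ^ p) (𝓝[>] 0) := by
        refine tsum_congr fun i => lintegral_congr_ae ?_
        filter_upwards [hderiv i] with t ht
        exact (ht.tendsto_slope_zero_right.enorm.ennrpow_const p).liminf_eq.symm
    _ ≤ ∑' i, liminf (fun h : ℝ => ∫⁻ t in S i,
          ‖h⁻¹ • (f (φ i (t + h)) - f (φ i t))‖ₑ ^ p) (𝓝[>] 0) := by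
        refine ENNReal.tsum_le_tsum fun i => lintegral_liminf_le fun h => ?_
        exact ((((hfm i).comp (measurable_add_const h)).sub (hfm i)).const_smul
          h⁻¹).enorm.pow_const p
    _ ≤ liminf (fun h : ℝ => ∑' i, ∫⁻ t in S i,
          ‖h⁻¹ • (f (φ i (t + h)) - f (φ i t))‖ₑ ^ p) (𝓝[>] 0) := tsum_liminf_le _
    _ ≤ liminf (fun _ : ℝ => B) (𝓝[>] 0) := by
        refine liminf_le_liminf ?_
        filter_upwards [Ioo_mem_nhdsGT hh₀] with h hh
        have hh0 := hh.1
        have key := tsum_lintegral_increment_le hφ hL hJ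
          (fun i => Metric.isClosed_cthickening.measurableSet) (fun i => (hS i).measurableSet)
          hΦ hm hp hK0 hK hfc hf hh0 hδ (fun i t ht u hu => ?_) hsep
        · have e : ∀ i t, ‖h⁻¹ • (f (φ i (t + h)) - f (φ i t))‖ₑ ^ p =
              ENNReal.ofReal (h⁻¹ ^ p) * ‖f (φ i (t + h)) - f (φ i t)‖ₑ ^ p := fun i t => by
            rw [enorm_smul, ENNReal.mul_rpow_of_nonneg _ _ hp0, Real.enorm_eq_ofReal (by positivity),
              ENNReal.ofReal_rpow_of_nonneg (by positivity) hp0]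
          simp_rw [e, lintegral_const_mul' _ _ ENNReal.ofReal_ne_top]
          rw [ENNReal.tsum_mul_left]
          refine (mul_le_mul' le_rfl key).trans (le_of_eq ?_)
          rw [hB, ← mul_assoc, ← ENNReal.ofReal_mul (by positivity), Real.inv_rpow hh0.le]
          congr 2
          have : 0 < h ^ p := Real.rpow_pos_of_pos hh0 p
          field_simp
        · refine Metric.mem_cthickening_of_dist_le _ t _ _ ht ?_
          rw [Real.dist_eq, add_sub_cancel_left, abs_of_nonneg hu.1]
          exact hu.2.trans hh.2.le
    _ = B := liminf_const B

/-- The gradient is controlled by the lower limit of the energies. -/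
theorem IsGradientModulus.lintegral_le {ι₀ : ℝ} (hX : IsLocalTree X (fun _ => ι₀))
    (hΦ : IsVolumeProfile Φ r₀) (hm : UniformVolumeControl m Φ r₀) (hp : 1 < p) (hK0 : 0 < K)
    (hK : AverageBound m p Φ r₀ K) {f G : X → ℝ} (hG : IsGradientModulus (fun _ => ι₀) f G)
    (hf : MemLp f (ENNReal.ofReal p) m) :
    ∫⁻ z, ‖G z‖ₑ ^ p ∂lengthMeasure (fun _ => ι₀) ≤
      ENNReal.ofReal (2 * 2 ^ p * 4 ^ (p - 1) * K) *
        liminf (fun r => ksEnergy m p (scaling p Φ) f r) (𝓝[>] 0) := by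
  rcases isEmpty_or_nonempty X with h | h
  · rw [lintegral_of_isEmpty]
    exact zero_le
  have hp0 : 0 ≤ p := by linarith
  obtain ⟨x, y, hxy, hskel⟩ := hX.exists_skeleton_eq
  choose φ hφ hL using fun n => hX.exists_isGeodesic (hxy n)
  set A : ℕ → Set X := fun n => openSeg (x n) (y n) with hA
  have hAm : ∀ n, MeasurableSet (A n) := fun n => hX.measurableSet_openSeg (hxy n)
  have hDm : ∀ n, MeasurableSet (disjointed A n) := MeasurableSet.disjointed hAm
  -- Overlapping segments are made disjoint, so that each point of the skeleton is counted once.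
  set T : ℕ → Set ℝ := fun n => φ n ⁻¹' disjointed A n ∩ Ioo 0 (dist (x n) (y n)) with hT
  have hTm : ∀ n, MeasurableSet (T n) := fun n =>
    ((hL n).continuous.measurable (hDm n)).inter measurableSet_Ioo
  set g : ℕ → ℝ → ℝ≥0∞ := fun n t => ‖deriv (fun s => f (φ n s)) t‖ₑ ^ p with hg
  have hGm : AEMeasurable (fun z => ‖G z‖ₑ ^ p) (lengthMeasure (fun _ : X => ι₀)) :=
    hG.2.1.enorm.pow_const p
  have e1 : ∫⁻ z, ‖G z‖ₑ ^ p ∂lengthMeasure (fun _ => ι₀) =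
      ∑' n, ∫⁻ z in disjointed A n, ‖G z‖ₑ ^ p ∂lengthMeasure (fun _ => ι₀) := by
    rw [← lintegral_iUnion hDm (disjoint_disjointed A), iUnion_disjointed, ← hskel]
    conv_rhs => rw [lengthMeasure, Measure.restrict_restrict_of_subset Subset.rfl]
    rfl
  have e2 : ∀ n, ∫⁻ z in disjointed A n, ‖G z‖ₑ ^ p ∂lengthMeasure (fun _ => ι₀) =
      ∫⁻ t in T n, g n t := by
    intro n
    have h1 : ∫⁻ z in disjointed A n, ‖G z‖ₑ ^ p ∂lengthMeasure (fun _ => ι₀) =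
        ∫⁻ z in A n, (disjointed A n).indicator (fun z => ‖G z‖ₑ ^ p) z
          ∂lengthMeasure (fun _ => ι₀) := by
      rw [setLIntegral_indicator (hDm n), inter_eq_self_of_subset_left (disjointed_subset A n)]
    rw [h1, hX.lintegral_openSeg (hxy n) (hφ n) (hL n) (hGm.restrict.indicator (hDm n)), hT,
      ← setLIntegral_indicator ((hL n).continuous.measurable (hDm n))]
    refine lintegral_congr_ae ?_
    filter_upwards [hG.ae_hasDerivAt hX (hxy n) (hφ n) (hL n)] with t ht
    by_cases hmem : φ n t ∈ disjointed A n
    · rw [indicator_of_mem hmem, indicator_of_mem (show t ∈ φ n ⁻¹' disjointed A n from hmem),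
        ht.2, ← Real.norm_eq_abs, enorm_norm]
    · rw [indicator_of_notMem hmem,
        indicator_of_notMem (show t ∉ φ n ⁻¹' disjointed A n from hmem)]
  rw [e1]
  simp_rw [e2]
  refine ENNReal.tsum_le_of_sum_range_le fun N => ?_
  rw [← Fin.sum_univ_eq_sum_range (fun n => ∫⁻ t in T n, g n t)]
  have hgt : ∀ n t, g n t ≠ ⊤ := fun n t => ENNReal.rpow_ne_top_of_nonneg hp0 enorm_ne_top
  -- The disjoint sets `T n` need not be separated; compact subsets, which are, exhaust their
  -- integrals even when these are infinite.
  have e3 : ∀ n, ∃ S : ℕ → Set ℝ, (∀ k, S k ⊆ T n ∧ IsCompact (S k)) ∧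
      Tendsto (fun k => ∫⁻ t in S k, g n t) atTop (𝓝 (∫⁻ t in T n, g n t)) := by
    intro n
    set Q : Set ℝ≥0∞ := (fun S => ∫⁻ t in S, g n t) '' {S | S ⊆ T n ∧ IsCompact S} with hQ
    have hsup : sSup Q = ∫⁻ t in T n, g n t := by
      refine le_antisymm (sSup_le ?_) (le_of_forall_lt fun c hc => ?_)
      · rintro _ ⟨S, hS, rfl⟩
        exact lintegral_mono_set hS.1
      · obtain ⟨S, hST, hS, hcS⟩ := exists_isCompact_lt_setLIntegral (hgt n) (hTm n) hc
        exact hcS.trans_le (le_sSup ⟨S, ⟨hST, hS⟩, rfl⟩)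
    obtain ⟨u, -, hu, huQ⟩ := exists_seq_tendsto_sSup (S := Q)
      ⟨_, ∅, ⟨empty_subset _, isCompact_empty⟩, rfl⟩ (OrderTop.bddAbove Q)
    choose S hS hSu using huQ
    exact ⟨S, hS, by rw [← hsup]; simpa only [hSu] using hu⟩
  choose S hS hSlim using e3
  refine le_of_tendsto' (tendsto_finsetSum _ fun (i : Fin N) _ => hSlim i) fun k => ?_
  refine (tsum_fintype (L := .unconditional _)
    (fun i : Fin N => ∫⁻ t in S i k, g i t)).symm.trans_le ?_
  refine tsum_lintegral_deriv_le (x := fun i : Fin N => x i) (y := fun i : Fin N => y i)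
    (φ := fun i : Fin N => φ i) (S := fun i : Fin N => S i k) (fun i => hφ i) (fun i => hL i)
    (fun i => (hS i k).2) (fun i => (hS i k).1.trans inter_subset_right) ?_ hΦ hm hp hK0 hK
    hG.1.1 hf ?_
  · intro i j hij
    refine (disjoint_disjointed A (Fin.val_ne_of_ne hij)).mono ?_ ?_
    · exact image_subset_iff.2 ((hS i k).1.trans inter_subset_left)
    · exact image_subset_iff.2 ((hS j k).1.trans inter_subset_left)
  · intro i
    exact ae_restrict_of_ae_restrict_of_subset ((hS i k).1.trans inter_subset_right)
      ((hG.ae_hasDerivAt hX (hxy i) (hφ i) (hL i)).mono fun t ht => ht.1)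

end LowerBound

/-! ### From the Korevaar–Schoen space to absolutely continuous representatives. -/

section Sobolev

variable {X : Type*} [MetricSpace X] [MeasurableSpace X] {m : Measure X} {Φ : ℝ → ℝ} {r₀ p K : ℝ}

theorem lintegral_enorm_rpow_lt_top_iff {α : Type*} [MeasurableSpace α] {μ : Measure α}
    (hp : 1 < p) {G : α → ℝ} (hG : AEStronglyMeasurable G μ) :
    ∫⁻ z, ‖G z‖ₑ ^ p ∂μ < ⊤ ↔ MemLp G (ENNReal.ofReal p) μ := by
  have h := eLpNorm_lt_top_iff_lintegral_rpow_enorm_lt_top (f := G) (μ := μ)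
    (p := ENNReal.ofReal p) (by simpa using by linarith) ENNReal.ofReal_ne_top
  rw [ENNReal.toReal_ofReal (by linarith)] at h
  rw [← h, MemLp, and_iff_right hG]

theorem liminf_ksEnergy_ne_top {f : Lp ℝ (ENNReal.ofReal p) m}
    (hf : f ∈ ksSpace m p (scaling p Φ)) :
    liminf (fun r => ksEnergy m p (scaling p Φ) f r) (𝓝[>] 0) ≠ ⊤ :=
  (lt_of_le_of_lt liminf_le_limsup hf).ne

variable [BorelSpace X] [SecondCountableTopology X] [SFinite m]

/-- Every function of the Korevaar–Schoen space has an absolutely continuous representative. -/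
theorem exists_isGradientModulus_of_mem_ksSpace {ι₀ : ℝ} (hX : IsLocalTree X (fun _ => ι₀))
    (hΦ : IsVolumeProfile Φ r₀) (hm : UniformVolumeControl m Φ r₀) (hp : 1 < p) (hK0 : 0 < K)
    (hK : AverageBound m p Φ r₀ K) {f : Lp ℝ (ENNReal.ofReal p) m}
    (hf : f ∈ ksSpace m p (scaling p Φ)) :
    ∃ f' G : X → ℝ, f =ᵐ[m] f' ∧ IsGradientModulus (fun _ => ι₀) f' G := by
  obtain ⟨M, hM, hMt⟩ := exists_between (show limsup (fun r : ℝ =>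
    ksEnergy m p (scaling p Φ) f r) (𝓝[>] 0) < ⊤ from hf)
  have hev := eventually_lt_of_limsup_lt hM
  obtain ⟨ρ, hρ, hsub⟩ := mem_nhdsGT_iff_exists_Ioo_subset.1 hev
  have hr₀ := hΦ.radius_pos
  obtain ⟨f', hf'c, hff'⟩ := exists_continuous_ae_eq hΦ hm hp hK0 hK
    (Lp.stronglyMeasurable f).measurable (Lp.memLp f) (ρ₀ := min ρ r₀) (M := M.toReal)
    (lt_min hρ hr₀) (min_le_right _ _) ENNReal.toReal_nonneg (fun r h0 h1 => by
      rw [ENNReal.ofReal_toReal hMt.ne]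
      exact (hsub ⟨h0, h1.trans_le (min_le_left _ _)⟩ : _ < M).le)
  have hL : liminf (fun r => ksEnergy m p (scaling p Φ) f' r) (𝓝[>] 0) ≠ ⊤ := by
    simp_rw [← ksEnergy_congr hff']
    exact liminf_ksEnergy_ne_top hf
  obtain ⟨G, hG⟩ := exists_isGradientModulus hX (fun x y φ _ hφ hLip =>
    absolutelyContinuousOnInterval_geodesic hΦ hm hp hK0 hK hf'c ((Lp.memLp f).ae_eq hff') hL hφ
      hLip) hf'c
  exact ⟨f', G, hff', hG⟩

end Sobolev

end LocalTree

end

/-! ### The main theorem. -/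

theorem theorem3p7 {X : Type*} [MetricSpace X] [LocallyCompactSpace X] [ConnectedSpace X]
    [TopologicalSpace.SeparableSpace X] [MeasurableSpace X] [BorelSpace X]
    (ι₀ : ℝ) (hX : LocalTree.IsUniformLocalTree X ι₀)
    (m : Measure X) [m.Regular] [m.IsOpenPosMeasure]
    (Φ : ℝ → ℝ) (r₀ : ℝ) (hΦ : LocalTree.IsVolumeProfile Φ r₀)
    (hm : LocalTree.UniformVolumeControl m Φ r₀)
    (p : ℝ) (hp : 1 < p) :
    LocalTree.ksSpace m p (LocalTree.scaling p Φ) =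
        LocalTree.sobolevSpace (fun _ => ι₀) m (ENNReal.ofReal p) ∧
      ∃ c C r₁ : ℝ, 0 < c ∧ 0 < C ∧ 0 < r₁ ∧ r₁ ≤ r₀ ∧
        ∀ f ∈ LocalTree.ksSpace m p (LocalTree.scaling p Φ),
          (∀ f' G : X → ℝ, f =ᵐ[m] f' →
            LocalTree.IsGradientModulus (fun _ => ι₀) f' G →
              ENNReal.ofReal c *
                  (⨆ r ∈ Ioc 0 r₁, LocalTree.ksEnergy m p (LocalTree.scaling p Φ) f r) ≤
                ∫⁻ z, ‖G z‖ₑ ^ p ∂(LocalTree.lengthMeasure (fun _ : X => ι₀)) ∧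
              ∫⁻ z, ‖G z‖ₑ ^ p ∂(LocalTree.lengthMeasure (fun _ : X => ι₀)) ≤
                ENNReal.ofReal C *
                  liminf (fun r : ℝ => LocalTree.ksEnergy m p (LocalTree.scaling p Φ) f r)
                    (𝓝[>] 0)) ∧
          (⨆ r ∈ Ioc 0 r₁, LocalTree.ksEnergy m p (LocalTree.scaling p Φ) f r) ≤
            ENNReal.ofReal (C / c) *
              liminf (fun r : ℝ => LocalTree.ksEnergy m p (LocalTree.scaling p Φ) f r)
                (𝓝[>] 0) := by
  have : SecondCountableTopology X := UniformSpace.secondCountable_of_separable X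
  have hT := hX.1
  have hι : 0 < ι₀ := (hT (Classical.arbitrary X)).1
  have hr₀ := hΦ.radius_pos
  obtain ⟨K, hK0, hK⟩ := LocalTree.exists_averageBound hΦ hm hp
  obtain ⟨c₂, C₂, -, hC₂, hball⟩ := id hm
  set C := 2 * 2 ^ p * 4 ^ (p - 1) * K with hC
  have hC0 : 0 < C := by positivity
  -- Halving the minimum makes `r < r₀` strict, as the volume control demands, even at the closed
  -- end of the interval.
  have upper : ∀ (f : Lp ℝ (ENNReal.ofReal p) m) (f' G : X → ℝ), f =ᵐ[m] f' →
      LocalTree.IsGradientModulus (fun _ => ι₀) f' G → ∀ r ∈ Ioc 0 (min r₀ ι₀ / 2),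
        LocalTree.ksEnergy m p (LocalTree.scaling p Φ) f r ≤
          ENNReal.ofReal C₂ * ∫⁻ z, ‖G z‖ₑ ^ p ∂(LocalTree.lengthMeasure (fun _ : X => ι₀)) := by
    intro f f' G hff' hG r hr
    have h1 := min_le_left r₀ ι₀
    have h2 := min_le_right r₀ ι₀
    rw [LocalTree.ksEnergy_congr hff']
    exact hG.ksEnergy_le hT hΦ hC₂ (fun x r h h' => (hball x r h h').2) hp hr.1
      (by linarith [hr.2]) (by linarith [hr.2])
  have lower : ∀ (f : Lp ℝ (ENNReal.ofReal p) m) (f' G : X → ℝ), f =ᵐ[m] f' →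
      LocalTree.IsGradientModulus (fun _ => ι₀) f' G →
        ∫⁻ z, ‖G z‖ₑ ^ p ∂(LocalTree.lengthMeasure (fun _ : X => ι₀)) ≤
          ENNReal.ofReal C *
            liminf (fun r : ℝ => LocalTree.ksEnergy m p (LocalTree.scaling p Φ) f r) (𝓝[>] 0) := by
    intro f f' G hff' hG
    simp_rw [LocalTree.ksEnergy_congr hff']
    exact hG.lintegral_le hT hΦ hm hp hK0 hK ((Lp.memLp f).ae_eq hff')
  have bounds : ∀ (f : Lp ℝ (ENNReal.ofReal p) m) (f' G : X → ℝ), f =ᵐ[m] f' →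
      LocalTree.IsGradientModulus (fun _ => ι₀) f' G →
        ENNReal.ofReal C₂⁻¹ * (⨆ r ∈ Ioc 0 (min r₀ ι₀ / 2),
          LocalTree.ksEnergy m p (LocalTree.scaling p Φ) f r) ≤
            ∫⁻ z, ‖G z‖ₑ ^ p ∂(LocalTree.lengthMeasure (fun _ : X => ι₀)) := by
    intro f f' G hff' hG
    refine (mul_le_mul' le_rfl (iSup₂_le (upper f f' G hff' hG))).trans (le_of_eq ?_)
    rw [← mul_assoc, ← ENNReal.ofReal_mul (by positivity), inv_mul_cancel₀ hC₂.ne',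
      ENNReal.ofReal_one, one_mul]
  refine ⟨Subset.antisymm ?_ ?_, C₂⁻¹, C, min r₀ ι₀ / 2, by positivity, hC0, by positivity, ?_, ?_⟩
  · intro f hf
    obtain ⟨f', G, hff', hG⟩ :=
      LocalTree.exists_isGradientModulus_of_mem_ksSpace hT hΦ hm hp hK0 hK hf
    refine ⟨f', hff', G, hG, (LocalTree.lintegral_enorm_rpow_lt_top_iff hp hG.2.1).1 ?_⟩
    exact (lower f f' G hff' hG).trans_lt (ENNReal.mul_lt_top ENNReal.ofReal_lt_top
      (LocalTree.liminf_ksEnergy_ne_top hf).lt_top)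
  · rintro f ⟨f', hff', G, hG, hGp⟩
    have hfin := (LocalTree.lintegral_enorm_rpow_lt_top_iff hp hG.2.1).2 hGp
    refine lt_of_le_of_lt (limsup_le_of_le (h := ?_))
      (ENNReal.mul_lt_top ENNReal.ofReal_lt_top hfin : ENNReal.ofReal C₂ * _ < ⊤)
    filter_upwards [Ioc_mem_nhdsGT (show 0 < min r₀ ι₀ / 2 by positivity)] with r hr
    exact upper f f' G hff' hG r hr
  · linarith [min_le_left r₀ ι₀]
  · intro f hf
    refine ⟨fun f' G hff' hG => ⟨bounds f f' G hff' hG, lower f f' G hff' hG⟩, ?_⟩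
    obtain ⟨f', G, hff', hG⟩ :=
      LocalTree.exists_isGradientModulus_of_mem_ksSpace hT hΦ hm hp hK0 hK hf
    -- Chaining the two bounds gives the constant `C₂ C`, which is `C / c` for `c = C₂⁻¹`.
    have h := (iSup₂_le (upper f f' G hff' hG)).trans
      (mul_le_mul' le_rfl (lower f f' G hff' hG))
    rwa [← mul_assoc, ← ENNReal.ofReal_mul hC₂.le, mul_comm C₂,
      show C * C₂ = C / C₂⁻¹ by rw [div_inv_eq_mul]] at h
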